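/- Let $\mathfrak g$ be a finite-dimensional complex reductive Lie algebra, realized as the Lie algebra of a connected complex linear group $G_{\mathbb C}$. Let $H\in\mathfrak g$ be hyperbolic (that is, $\operatorname{ad}H$ is diagonalizable with real eigenvalues), and let $\mathfrak n_-$, $\mathfrak l$, $\mathfrak n_+$ be the sums of the eigenspaces of $\operatorname{ad}H$ with negative, zero and positive eigenvalues, so that $\mathfrak p=\mathfrak l+\mathfrak n_+$ is a parabolic subalgebra with opposite nilradical $\mathfrak n_-$. Let $L_{\mathbb C}$ be the centralizer of $H$ in $G_{\mathbb C}$. Assume that $\mathfrak n_+$ is abelian. For $g$ in $\exp(\mathfrak n_-)\,L_{\mathbb C}\exp(\mathfrak n_+)$ write $g=\exp(p_-(g))\,p_o(g)\exp(p_+(g))$ with $p_\pm(g)\in\mathfrak n_\pm$, $p_o(g)\in L_{\mathbb C}$, and for $Y\in\mathfrak g$, $X\in\mathfrak n_-$ put $$\alpha(Y,X)=\tfrac{d}{dt}\Big|_{t=0}p_o(e^{tY}e^X)\in\mathfrak l,\qquad \beta(Y,X)=\tfrac{d}{dt}\Big|_{t=0}p_-(e^{tY}e^X)\in\mathfrak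 n_-.$$ For a representation $\mu$ of $\mathfrak l$ on a complex vector space $V^\vee$ let $d\pi_\mu(Y)$ be the operator $$(d\pi_\mu(Y)F)(X)=\mu(\alpha(Y,X))F(X)-(\beta(Y,\cdot)F)(X)$$ on $V^\vee$-valued functions on $\mathfrak n_-$, where $\beta(Y,\cdot)$ is regarded as a vector field on $\mathfrak n_-$. Let $z_1,\dots,z_n$ be linear coordinates on $\mathfrak n_-$ with respect to a basis $e_1,\dots,e_n$. Then $\mathfrak n_+$ has a basis $e_1',\dots,e_n'$ dual to it with respect to the Killing form of $\mathfrak g$; let $\xi^1,\dots,\xi^n$ be the corresponding linear coordinates on $\mathfrak n_+\simeq\mathfrak n_-^\vee$. Write $\mathcal D(E)$ for the Weyl algebra of differential operators with polynomial coefficients on $E$, and let $T\mapsto\widehat T$, $\mathcal D(\mathfrak n_-)\otimes\operatorname{End}(V^\vee)\to\mathcal D(\mathfrak n_+)\otimes\operatorname{End}(V^\vee)$, be the algebraic Fourier transform, that is, the algebra homomorphism given by $\widehat{\partial/\partial z_j}=-\xi^j$, $\widehat{z_j}=\partial/\partial\xi^j$ and the identity on $\operatorname{End}(V^\vee)$.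 Then for every $Y\in\mathfrak n_+$ the operator $d\pi_\mu(Y)$ is given by a unique element of $\mathcal D(\mathfrak n_-)\otimes\operatorname{End}(V^\vee)$, and its algebraic Fourier transform $\widehat{d\pi_\mu}(Y)$ is homogeneous of degree $-1$, that is, $R_c\,\widehat{d\pi_\mu}(Y)\,R_c^{-1}=c^{-1}\,\widehat{d\pi_\mu}(Y)$ for all $c\in\mathbb C\setminus\{0\}$, where $(R_ch)(\xi)=h(c\xi)$. More precisely, $$\widehat{d\pi_\mu}(Y)=\sum_{i,j,k}a_i^{jk}\,\xi^i\frac{\partial^2}{\partial\xi^j\partial\xi^k}+\sum_j b^j\frac{\partial}{\partial\xi^j},$$ where, in the given coordinates, the constants $a_i^{jk}\in\mathbb C$ depend only on $Y$ and the constants $b^j\in\operatorname{End}(V^\vee)$ depend only on $Y$ and $\mu$. In particular $\widehat{d\pi_\mu}(Y)$ is a differential operator of order at most two. -/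

import Mathlib

open scoped TensorProduct Topology

universe v

attribute [local instance 100] LieRing.ofAssociativeRing

namespace FMethod

/-! ### The Weyl algebra and the algebraic Fourier transform -/

section Weyl

variable (κ : Type*)

/-- The canonical commutation relations between the coordinates `z i` (generators `Sum.inl i`)
and the derivations `∂ i` (generators `Sum.inr i`). -/
inductive WeylRel : FreeAlgebra ℂ (κ ⊕ κ) → FreeAlgebra ℂ (κ ⊕ κ) → Prop
  | coord (i j : κ) : WeylRel
      (FreeAlgebra.ι ℂ (Sum.inl i) * FreeAlgebra.ι ℂ (Sum.inl j))
      (FreeAlgebra.ι ℂ (Sum.inl j) * FreeAlgebra.ι ℂ (Sum.inl i))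
  | partial_partial (i j : κ) : WeylRel
      (FreeAlgebra.ι ℂ (Sum.inr i) * FreeAlgebra.ι ℂ (Sum.inr j))
      (FreeAlgebra.ι ℂ (Sum.inr j) * FreeAlgebra.ι ℂ (Sum.inr i))
  | partial_coord_same (i : κ) : WeylRel
      (FreeAlgebra.ι ℂ (Sum.inr i) * FreeAlgebra.ι ℂ (Sum.inl i))
      (FreeAlgebra.ι ℂ (Sum.inl i) * FreeAlgebra.ι ℂ (Sum.inr i) + 1)
  | partial_coord_ne (i j : κ) (h : i ≠ j) : WeylRel
      (FreeAlgebra.ι ℂ (Sum.inr i) * FreeAlgebra.ι ℂ (Sum.inl j))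
      (FreeAlgebra.ι ℂ (Sum.inl j) * FreeAlgebra.ι ℂ (Sum.inr i))

/-- The complex Weyl algebra `𝒟(E)` of a vector space `E` with linear coordinates indexed by
`κ`: the ring of differential operators on `E` with polynomial coefficients, presented by the
coordinates `z i` and the derivations `∂ i`. -/
def WeylAlgebra : Type _ := RingQuot (WeylRel κ)

noncomputable instance : Ring (WeylAlgebra κ) := inferInstanceAs (Ring (RingQuot (WeylRel κ)))

noncomputable instance : Algebra ℂ (WeylAlgebra κ) :=
  inferInstanceAs (Algebra ℂ (RingQuot (WeylRel κ)))

/-- The universal property of the presentation. -/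
noncomputable def weylLift {A : Type*} [Ring A] [Algebra ℂ A] (f : κ ⊕ κ → A)
    (h : ∀ ⦃x y⦄, WeylRel κ x y → FreeAlgebra.lift ℂ f x = FreeAlgebra.lift ℂ f y) :
    WeylAlgebra κ →ₐ[ℂ] A :=
  RingQuot.liftAlgHom ℂ ⟨FreeAlgebra.lift ℂ f, h⟩

/-- The quotient map from the free algebra. -/
noncomputable def weylMk : FreeAlgebra ℂ (κ ⊕ κ) →ₐ[ℂ] WeylAlgebra κ :=
  RingQuot.mkAlgHom ℂ (WeylRel κ)

theorem weylLift_weylMk {A : Type*} [Ring A] [Algebra ℂ A] (f : κ ⊕ κ → A)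
    (h : ∀ ⦃x y⦄, WeylRel κ x y → FreeAlgebra.lift ℂ f x = FreeAlgebra.lift ℂ f y)
    (x : FreeAlgebra ℂ (κ ⊕ κ)) : weylLift κ f h (weylMk κ x) = FreeAlgebra.lift ℂ f x :=
  RingQuot.liftAlgHom_mkAlgHom_apply ℂ _ _ x

theorem weylMk_rel {x y : FreeAlgebra ℂ (κ ⊕ κ)} (h : WeylRel κ x y) :
    (weylMk κ) x = (weylMk κ) y :=
  RingQuot.mkAlgHom_rel ℂ h

variable {κ}

/-- The generator `z i` of the Weyl algebra (multiplication by the `i`-th coordinate). -/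
noncomputable def wz (i : κ) : WeylAlgebra κ :=
  weylMk κ (FreeAlgebra.ι ℂ (Sum.inl i))

/-- The generator `∂ i` of the Weyl algebra (the `i`-th partial derivative). -/
noncomputable def wd (i : κ) : WeylAlgebra κ :=
  weylMk κ (FreeAlgebra.ι ℂ (Sum.inr i))

theorem wz_mul_wz (i j : κ) : wz i * wz j = wz j * wz i := by
  simpa [wz, map_mul] using weylMk_rel κ (WeylRel.coord i j)

theorem wd_mul_wd (i j : κ) : wd i * wd j = wd j * wd i := by
  simpa [wd, map_mul] using weylMk_rel κ (WeylRel.partial_partial i j)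

theorem wd_mul_wz_same (i : κ) : wd i * wz i = wz i * wd i + 1 := by
  simpa [wz, wd, map_mul] using weylMk_rel κ (WeylRel.partial_coord_same i)

theorem wd_mul_wz_ne (i j : κ) (h : i ≠ j) : wd i * wz j = wz j * wd i := by
  simpa [wz, wd, map_mul] using weylMk_rel κ (WeylRel.partial_coord_ne i j h)

/-- The action of the Weyl algebra on polynomials: `z i` acts by multiplication by the `i`-th
variable and `∂ i` acts by the `i`-th partial derivative. -/
noncomputable def weylAct : WeylAlgebra κ →ₐ[ℂ] Module.End ℂ (MvPolynomial κ ℂ) :=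
  weylLift κ
    (Sum.elim
        (fun i => LinearMap.mulLeft ℂ (MvPolynomial.X i : MvPolynomial κ ℂ))
        (fun i => ((MvPolynomial.pderiv i : Derivation ℂ (MvPolynomial κ ℂ)
          (MvPolynomial κ ℂ)) : Module.End ℂ (MvPolynomial κ ℂ)))) (by
      classical
      intro x y h
      cases h with
      | coord i j =>
        apply LinearMap.ext
        intro p
        simp [mul_left_comm]
      | partial_partial i j =>
        have hc : ⁅(MvPolynomial.pderiv i : Derivation ℂ (MvPolynomial κ ℂ)
            (MvPolynomial κ ℂ)), (MvPolynomial.pderiv j : Derivation ℂ (MvPolynomial κ ℂ)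
            (MvPolynomial κ ℂ))⁆ = 0 := by
          apply MvPolynomial.derivation_ext
          intro k
          simp [Derivation.commutator_apply, MvPolynomial.pderiv_X, Pi.single_apply, apply_ite]
        apply LinearMap.ext
        intro p
        have := congrArg (fun D : Derivation ℂ (MvPolynomial κ ℂ) (MvPolynomial κ ℂ) => D p) hc
        simpa [Derivation.commutator_apply, sub_eq_zero] using this
      | partial_coord_same i =>
        apply LinearMap.ext
        intro p
        simp
      | partial_coord_ne i j h =>
        apply LinearMap.ext
        intro p
        simp [MvPolynomial.pderiv_X_of_ne (Ne.symm h)])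

theorem weylAct_wz (i : κ) (p : MvPolynomial κ ℂ) :
    weylAct (wz i) p = MvPolynomial.X i * p := by
  simp [weylAct, wz, weylLift_weylMk]

theorem weylAct_wd (i : κ) (p : MvPolynomial κ ℂ) :
    weylAct (wd i) p = MvPolynomial.pderiv i p := by
  simp [weylAct, wd, weylLift_weylMk]

/-- The algebraic Fourier transform `𝒟(E) → 𝒟(E^∨)`, `∂/∂z_i ↦ -ζ_i`, `z_i ↦ ∂/∂ζ_i`,
where `ζ` are the linear coordinates on `E^∨` dual to the linear coordinates `z` on `E`. -/
noncomputable def fourier : WeylAlgebra κ →ₐ[ℂ] WeylAlgebra κ :=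
  weylLift κ (A := WeylAlgebra κ) (Sum.elim (fun i => wd i) (fun i => - wz i)) (by
      intro x y h
      cases h with
      | coord i j => simpa using wd_mul_wd i j
      | partial_partial i j => simpa using wz_mul_wz i j
      | partial_coord_same i => simp [wd_mul_wz_same]
      | partial_coord_ne i j h => simp [wd_mul_wz_ne j i (Ne.symm h)])

theorem fourier_wd (i : κ) : fourier (wd i) = - wz i := by
  rw [wd, fourier, weylLift_weylMk]
  simp

theorem fourier_wz (i : κ) : fourier (wz i) = wd i := by
  rw [wz, fourier, weylLift_weylMk]
  simp

variable (V : Type*) [AddCommGroup V] [Module ℂ V]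

/-- Differential operators with polynomial coefficients acting on `V`-valued functions:
`𝒟(E) ⊗ End(V)`. -/
abbrev VWeyl (κ : Type*) (V : Type*) [AddCommGroup V] [Module ℂ V] : Type _ :=
  WeylAlgebra κ ⊗[ℂ] Module.End ℂ V

/-- `V`-valued polynomials `Pol(E) ⊗ V`. -/
abbrev VPol (κ : Type*) (V : Type*) [AddCommGroup V] [Module ℂ V] : Type _ :=
  MvPolynomial κ ℂ ⊗[ℂ] V

variable {V}

/-- The algebraic Fourier transform on `𝒟(E) ⊗ End(V)`, trivial on the second factor. -/
noncomputable def vfourier : VWeyl κ V →ₐ[ℂ] VWeyl κ V :=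
  Algebra.TensorProduct.map fourier (AlgHom.id ℂ (Module.End ℂ V))

/-- The action of `𝒟(E) ⊗ End(V)` on `Pol(E) ⊗ V`. -/
noncomputable def vact : VWeyl κ V →ₐ[ℂ] Module.End ℂ (VPol κ V) :=
  (Module.endTensorEndAlgHom (R := ℂ) (S := ℂ) (A := ℂ) (M := MvPolynomial κ ℂ)
    (N := V)).comp (Algebra.TensorProduct.map weylAct (AlgHom.id ℂ (Module.End ℂ V)))

/-- The value at a point `x : E` of a `V`-valued polynomial, in the linear coordinates of the
basis `e` of `E`. -/
noncomputable def polyEval {E : Type*} [AddCommGroup E] [Module ℂ E]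
    (e : Module.Basis κ ℂ E) (x : E) : VPol κ V →ₗ[ℂ] V :=
  (TensorProduct.lid ℂ V).toLinearMap ∘ₗ
    LinearMap.rTensor V (MvPolynomial.aeval (fun i => e.repr x i)).toLinearMap

/-- The dilation `(R_c h)(ξ) = h(c ξ)` on `V`-valued polynomials. -/
noncomputable def dilate (c : ℂ) : Module.End ℂ (VPol κ V) :=
  LinearMap.rTensor V
    (MvPolynomial.aeval (R := ℂ) (fun i => c • (MvPolynomial.X i : MvPolynomial κ ℂ))).toLinearMap

/-- An operator `T` with polynomial coefficients on `V`-valued functions on `E`, written in the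
linear coordinates of the basis `e` of `E`, is homogeneous of degree `d` if
`R_c T R_c⁻¹ = c ^ d T` for all `c ≠ 0` (so `∂/∂ξ_i` has degree `-1` and `ξ_i` has
degree `1`). -/
def IsHomogeneousOfDegree {E : Type*} [AddCommGroup E] [Module ℂ E] (e : Module.Basis κ ℂ E)
    (d : ℤ) (T : VWeyl κ V) : Prop :=
  ∀ c : ℂ, c ≠ 0 → ∀ (h : VPol κ V) (ξ : E),
    polyEval e (c • ξ) (vact T (dilate c⁻¹ h)) = c ^ d • polyEval e ξ (vact T h)

/-- A differential operator has order at most `k` if its `k + 1`-fold iterated commutators with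
the coordinate functions vanish. -/
def HasOrderLE : ℕ → VWeyl κ V → Prop
  | 0, T => ∀ i : κ, T * (wz i ⊗ₜ[ℂ] 1) - (wz i ⊗ₜ[ℂ] 1) * T = 0
  | k + 1, T => ∀ i : κ, 
      HasOrderLE k (T * (wz i ⊗ₜ[ℂ] 1) - (wz i ⊗ₜ[ℂ] 1) * T)

end Weyl

/-! ### Parabolic subalgebras and the Gelfand–Naimark decomposition -/

section Parabolic

variable {𝔤 : Type*} [LieRing 𝔤] [LieAlgebra ℂ 𝔤]

/-- `H` is hyperbolic: `ad H` is diagonalizable with real eigenvalues. -/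
def IsHyperbolic (H : 𝔤) : Prop :=
  ⨆ r : ℝ, Module.End.eigenspace (LieAlgebra.ad ℂ 𝔤 H) (r : ℂ) = ⊤

/-- The nilradical `𝔫₊` of the parabolic subalgebra defined by `H`: the sum of the eigenspaces
of `ad H` for positive eigenvalues. -/
def nPos (H : 𝔤) : Submodule ℂ 𝔤 :=
  ⨆ r : {r : ℝ // 0 < r}, Module.End.eigenspace (LieAlgebra.ad ℂ 𝔤 H) ((r : ℝ) : ℂ)

/-- The opposite nilradical `𝔫₋`: the sum of the eigenspaces of `ad H` for negative
eigenvalues. -/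
def nNeg (H : 𝔤) : Submodule ℂ 𝔤 :=
  ⨆ r : {r : ℝ // r < 0}, Module.End.eigenspace (LieAlgebra.ad ℂ 𝔤 H) ((r : ℝ) : ℂ)

/-- The Levi subalgebra `𝔩`: the zero eigenspace of `ad H`. -/
def levi (H : 𝔤) : LieSubalgebra ℂ 𝔤 where
  toSubmodule := LinearMap.ker (LieAlgebra.ad ℂ 𝔤 H : 𝔤 →ₗ[ℂ] 𝔤)
  lie_mem' := by
    intro x y hx hy
    simp only [AddSubsemigroup.mem_carrier, AddSubmonoid.mem_toSubsemigroup,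
      Submodule.mem_toAddSubmonoid, LinearMap.mem_ker, LieAlgebra.ad_apply] at hx hy ⊢
    rw [leibniz_lie, hx, hy]
    simp

variable {m : Type*} [Fintype m] [DecidableEq m] (j : 𝔤 →ₗ⁅ℂ⁆ Matrix m m ℂ)

/-- The connected complex linear group `G_ℂ` with Lie algebra `j(𝔤)`: the group generated by
the exponentials of the elements of `j(𝔤)`. -/
def linearGroup : Subgroup (Matrix m m ℂ)ˣ :=
  Subgroup.closure {g | ∃ Y : 𝔤, (g : Matrix m m ℂ) = NormedSpace.exp (j Y)}

/-- The Levi subgroup `L_ℂ`: the centralizer in `G_ℂ` of the hyperbolic element `H`. -/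
def leviGroup (H : 𝔤) : Set (Matrix m m ℂ)ˣ :=
  {g | g ∈ linearGroup j ∧
    (g : Matrix m m ℂ) * j H * ((g⁻¹ : (Matrix m m ℂ)ˣ) : Matrix m m ℂ) = j H}

/-- `g = exp(X) ℓ exp(Z)` with `X ∈ 𝔫₋`, `ℓ ∈ L_ℂ`, `Z ∈ 𝔫₊`. -/
def IsGelfandNaimark (H : 𝔤) (g : Matrix m m ℂ)
    (d : nNeg H × (Matrix m m ℂ)ˣ × nPos H) : Prop :=
  d.2.1 ∈ leviGroup j H ∧
    g = NormedSpace.exp (j d.1) * (d.2.1 : Matrix m m ℂ) * NormedSpace.exp (j d.2.2)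

open Classical in
/-- The triple `(p₋(g), p_o(g), p₊(g))` of components of `g ∈ G_ℂ^reg` (by convention
`(0, 1, 0)` if `g` is not in the image of the Gelfand–Naimark map). -/
noncomputable def gnProj (H : 𝔤) (g : Matrix m m ℂ) :
    nNeg H × (Matrix m m ℂ)ˣ × nPos H :=
  if h : ∃ d, IsGelfandNaimark j H g d then h.choose else (0, 1, 0)

/-- The curve `t ↦ e^{tY} e^X` in `G_ℂ`. -/
noncomputable def curve (Y X : 𝔤) (t : ℝ) : Matrix m m ℂ :=
  NormedSpace.exp ((t : ℂ) • j Y) * NormedSpace.exp (j X)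

/-- `a = α(Y, X)`: near `t = 0` the curve `e^{tY} e^X` stays in `G_ℂ^reg`, and `a ∈ 𝔩` is the
derivative at `t = 0` of `p_o(e^{tY} e^X)`. -/
def IsAlpha (H : 𝔤) (Y : 𝔤) (X : nNeg H) (a : levi H) : Prop :=
  (∀ᶠ t : ℝ in 𝓝 0, ∃ d, IsGelfandNaimark j H (curve j Y X t) d) ∧
    HasDerivAt (fun t : ℝ => (((gnProj j H (curve j Y X t)).2.1 : (Matrix m m ℂ)ˣ) :
      Matrix m m ℂ)) (j a) 0

/-- `b = β(Y, X)`: near `t = 0` the curve `e^{tY} e^X` stays in `G_ℂ^reg`, and `b ∈ 𝔫₋` is the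
derivative at `t = 0` of `p₋(e^{tY} e^X)`. -/
def IsBeta (H : 𝔤) (Y : 𝔤) (X : nNeg H) (b : nNeg H) : Prop :=
  (∀ᶠ t : ℝ in 𝓝 0, ∃ d, IsGelfandNaimark j H (curve j Y X t) d) ∧
    HasDerivAt (fun t : ℝ => j ((gnProj j H (curve j Y X t)).1 : 𝔤)) (j b) 0

/-- `D ∈ 𝒟(𝔫₋) ⊗ End(V)` is the operator `dπ_μ(Y)`, that is,
`(D F)(X) = μ(α(Y, X)) F(X) - (β(Y, ·) F)(X)`, where `β(Y, ·)` is regarded as the vector field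
`∑ i, β(Y, ·)_i ∂/∂z_i` in the coordinates `z` of the basis `e` of `𝔫₋`. -/
def IsInfinitesimalAction {κ : Type*} [Fintype κ] {V : Type*} [AddCommGroup V] [Module ℂ V]
    (H : 𝔤) (e : Module.Basis κ ℂ (nNeg H)) (μ : levi H →ₗ⁅ℂ⁆ Module.End ℂ V) (Y : 𝔤)
    (D : VWeyl κ V) : Prop :=
  ∀ X : nNeg H, ∃ (a : levi H) (b : nNeg H), IsAlpha j H Y X a ∧ IsBeta j H Y X b ∧
    ∀ F : VPol κ V,
      polyEval e X (vact D F) = μ a (polyEval e X F) -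
        ∑ i, e.repr b i •
          polyEval e X (LinearMap.rTensor V (MvPolynomial.pderiv i).toLinearMap F)

end Parabolic

end FMethod

namespace FMethod

/-! ### Sums of eigenspaces -/

section EigenSum

variable {M : Type*} [AddCommGroup M] [Module ℂ M]

/-! Everything rests on the finite expansion Ad(exp(-X))Y = Y - [X,Y] + ½[X,[X,Y]] for X ∈ 𝔫₋ and Y
∈ 𝔫₊, whose three terms lie in 𝔫₊, 𝔩 and 𝔫₋. Its components give α(Y,X) = -[X,Y], linear in X, and
β(Y,X) = ½[X,[X,Y]], quadratic in X (`isAlpha_isBeta`). So dπ_μ(Y) combines terms z_k ⊗ A_k and z_k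
z_l ∂/∂z_i. The Fourier transform turns these into ∂/∂ξ^k ⊗ A_k and -(∂²/∂ξ^k∂ξ^l) ξ^i, and moving
ξ^i to the left costs only first-order terms (`vfourier_quadraticOperator`). Degree and order are
then visible.

The algebraic input is that 𝔫₋ is abelian as well (`lie_eq_zero_of_mem_nNeg`) and that [𝔫₋,𝔫₊] ⊂ 𝔩
(`lie_mem_levi`), although ad H may have several positive eigenvalues. Both follow by pairing a
bracket with the opposite eigenspace: the Killing form of a reductive algebra is nondegenerate
modulo the center, and the center meets no nonzero eigenspace of ad H with nonzero eigenvalue. For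
the first claim the pairing vanishes by a Jacobson-type nilpotency argument
(`isNilpotent_lie_of_lie_lie_eq_zero`).

Since α and β are derivatives of projections in the group, the decomposition of e^{tY}e^X must exist
for small t and be unique. Existence comes from solving an ODE for the factors and checking that
their product is the given curve (`exists_decomposition_curve`). Uniqueness compares positive and
negative eigenvectors of ad j(H) on matrices (`eq_zero_of_exp_mul_eq`). Uniqueness of the
differential operator is faithfulness of the Weyl algebra on polynomials (`vact_injective`),
together with the fact that polynomials are determined by their values. -/

/-- The sum of the eigenspaces of `f` for the real eigenvalues in `S`. -/
def eigenSum (f : Module.End ℂ M) (S : Set ℝ) : Submodule ℂ M :=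
  ⨆ r : S, Module.End.eigenspace f ((r : ℝ) : ℂ)

theorem mem_eigenSum_of_mem {f : Module.End ℂ M} {S : Set ℝ} {r : ℝ} (hr : r ∈ S) {x : M}
    (hx : x ∈ Module.End.eigenspace f (r : ℂ)) : x ∈ eigenSum f S :=
  Submodule.mem_iSup_of_mem (⟨r, hr⟩ : S) hx

theorem eigenSum_induction {f : Module.End ℂ M} {S : Set ℝ} {p : M → Prop}
    (h : ∀ r ∈ S, ∀ x ∈ Module.End.eigenspace f (r : ℂ), p x) (h0 : p 0)
    (hadd : ∀ x y, p x → p y → p (x + y)) {x : M} (hx : x ∈ eigenSum f S) : p x :=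
  Submodule.iSup_induction (fun r : S => Module.End.eigenspace f ((r : ℝ) : ℂ)) (motive := p) hx
    (fun r y hy => h r r.2 y hy) h0 hadd

theorem disjoint_eigenSum (f : Module.End ℂ M) {S T : Set ℝ} (h : Disjoint S T) :
    Disjoint (eigenSum f S) (eigenSum f T) := by
  have key : ∀ S : Set ℝ, eigenSum f S = ⨆ r ∈ S, Module.End.eigenspace f (r : ℂ) :=
    fun S => (iSup_subtype' (p := fun r => r ∈ S)
      (f := fun r _ => Module.End.eigenspace f (r : ℂ))).symm
  have hind : iSupIndep fun r : ℝ => Module.End.eigenspace f (r : ℂ) :=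
    (Module.End.eigenspaces_iSupIndep f).comp Complex.ofReal_injective
  rw [key, key]
  exact hind.disjoint_biSup_biSup h

theorem eigenspace_eq_eigenSum (f : Module.End ℂ M) (r : ℝ) :
    Module.End.eigenspace f (r : ℂ) = eigenSum f {r} := by
  simp [eigenSum]

/-- An intertwiner preserves eigenvalues. It is applied to ad u with u ∈ 𝔩, to the realization `j`,
and to conjugation by a matrix commuting with j(H). -/
theorem eigenSum_mapsTo {N : Type*} [AddCommGroup N] [Module ℂ N] {f : Module.End ℂ M}
    {g : Module.End ℂ N} (φ : M →ₗ[ℂ] N) (h : ∀ x, φ (f x) = g (φ x)) {S : Set ℝ} {x : M}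
    (hx : x ∈ eigenSum f S) : φ x ∈ eigenSum g S := by
  refine eigenSum_induction (p := fun x => φ x ∈ eigenSum g S) ?_ (by simp)
    (fun x y hx hy => by simpa using add_mem hx hy) hx
  intro r hr x hx
  refine mem_eigenSum_of_mem hr ?_
  rw [Module.End.mem_eigenspace_iff] at hx ⊢
  rw [← h, hx, map_smul]

end EigenSum

/-! ### A nilpotency criterion -/

section Jacobson

variable {A : Type*} [Ring A] [Algebra ℂ A]

/-- Leibniz rule for the derivation ad a: since it kills `b` after two steps, only two terms of the
binomial expansion remain. -/
theorem ad_iterate_mul {a b : A} (h : ⁅a, ⁅a, b⁆⁆ = 0) (n : ℕ) (y : A) :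
    ((LieAlgebra.ad ℂ A a) ^ (n + 1)) (b * y) =
      b * ((LieAlgebra.ad ℂ A a) ^ (n + 1)) y +
        (n + 1 : ℂ) • (⁅a, b⁆ * ((LieAlgebra.ad ℂ A a) ^ n) y) := by
  have hc : a * ⁅a, b⁆ = ⁅a, b⁆ * a := by
    rw [Ring.lie_def a ⁅a, b⁆] at h
    exact sub_eq_zero.1 h
  have hb : a * b = b * a + ⁅a, b⁆ := by rw [Ring.lie_def]; abel
  generalize ⁅a, b⁆ = c at hc hb
  have step : ∀ z, ⁅a, b * z⁆ = b * ⁅a, z⁆ + c * z := by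
    intro z
    rw [Ring.lie_def, Ring.lie_def, ← mul_assoc, hb]
    noncomm_ring
  have stepc : ∀ z, ⁅a, c * z⁆ = c * ⁅a, z⁆ := by
    intro z
    rw [Ring.lie_def, Ring.lie_def, ← mul_assoc, hc]
    noncomm_ring
  induction n with
  | zero => simp [step]
  | succ n ih =>
    have hs : ∀ k z, ((LieAlgebra.ad ℂ A a) ^ (k + 1)) z = ⁅a, ((LieAlgebra.ad ℂ A a) ^ k) z⁆ :=
      fun k z => by rw [pow_succ', Module.End.mul_apply, LieAlgebra.ad_apply]
    rw [hs, ih, lie_add, lie_smul, step, stepc, hs (n + 1) y, hs n y, Nat.cast_succ]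
    module

/-- Each factor `b` can absorb at most one ad a, so n derivations must hit the n factors once each,
in n! orders, and one more derivation has nothing left to hit. -/
theorem ad_iterate_pow {a b : A} (h : ⁅a, ⁅a, b⁆⁆ = 0) (n : ℕ) :
    ((LieAlgebra.ad ℂ A a) ^ n) (b ^ n) = (n.factorial : ℂ) • ⁅a, b⁆ ^ n ∧
      ((LieAlgebra.ad ℂ A a) ^ (n + 1)) (b ^ n) = 0 := by
  have hc : ∀ k, ⁅a, ⁅a, b⁆ ^ k⁆ = 0 := by
    intro k
    rw [Ring.lie_def a ⁅a, b⁆] at h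
    rw [Ring.lie_def, sub_eq_zero]
    exact Commute.pow_right (sub_eq_zero.1 h) k
  induction n with
  | zero => simp [Ring.lie_def]
  | succ n ih =>
    have h1 : ((LieAlgebra.ad ℂ A a) ^ (n + 1)) (b ^ (n + 1)) =
        ((n + 1).factorial : ℂ) • ⁅a, b⁆ ^ (n + 1) := by
      rw [pow_succ' b, ad_iterate_mul h, ih.1, ih.2, Nat.factorial_succ, pow_succ' ⁅a, b⁆]
      push_cast
      rw [mul_zero, zero_add, mul_smul_comm, smul_smul]
    refine ⟨h1, ?_⟩
    rw [pow_succ', Module.End.mul_apply, h1, map_smul, LieAlgebra.ad_apply, hc, smul_zero]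

/-- If `a` is nilpotent and commutes with `[a, b]`, then `[a, b]` is nilpotent. -/
theorem isNilpotent_lie_of_lie_lie_eq_zero {a b : A} (ha : IsNilpotent a)
    (h : ⁅a, ⁅a, b⁆⁆ = 0) : IsNilpotent ⁅a, b⁆ := by
  obtain ⟨n, hn⟩ := LieAlgebra.ad_nilpotent_of_nilpotent (R := ℂ) ha
  refine ⟨n, ?_⟩
  -- Here (ad a)^n = 0, so the identity reads 0 = n!·[a,b]^n, and n! is invertible in ℂ.
  have := (ad_iterate_pow h n).1
  rw [hn, LinearMap.zero_apply, eq_comm, smul_eq_zero] at this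
  exact this.resolve_left (by exact_mod_cast n.factorial_ne_zero)

end Jacobson

/-! ### The structure of the parabolic decomposition -/

section Structure

variable {𝔤 : Type*} [LieRing 𝔤] [LieAlgebra ℂ 𝔤] {H : 𝔤}

theorem mem_levi {x : 𝔤} : x ∈ levi H ↔ ⁅H, x⁆ = 0 := by
  change x ∈ LinearMap.ker _ ↔ _
  simp

theorem lie_mem_eigenspace {a b : ℝ} {x y : 𝔤}
    (hx : x ∈ Module.End.eigenspace (LieAlgebra.ad ℂ 𝔤 H) (a : ℂ))
    (hy : y ∈ Module.End.eigenspace (LieAlgebra.ad ℂ 𝔤 H) (b : ℂ)) :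
    ⁅x, y⁆ ∈ Module.End.eigenspace (LieAlgebra.ad ℂ 𝔤 H) ((a + b : ℝ) : ℂ) := by
  rw [Module.End.mem_eigenspace_iff, LieAlgebra.ad_apply] at *
  rw [leibniz_lie, hx, hy, smul_lie, lie_smul, ← add_smul]
  push_cast
  rfl

/-- Invariance of the form under ad H gives (a + b)·κ(x,y) = 0. -/
theorem killingForm_eq_zero_of_add_ne_zero {a b : ℝ} {x y : 𝔤}
    (hx : x ∈ Module.End.eigenspace (LieAlgebra.ad ℂ 𝔤 H) (a : ℂ))
    (hy : y ∈ Module.End.eigenspace (LieAlgebra.ad ℂ 𝔤 H) (b : ℂ)) (h : a + b ≠ 0) :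
    killingForm ℂ 𝔤 x y = 0 := by
  rw [Module.End.mem_eigenspace_iff, LieAlgebra.ad_apply] at *
  have h1 := LieModule.traceForm_apply_lie_apply ℂ 𝔤 𝔤 x H y
  rw [hy, ← lie_skew, hx] at h1
  simp only [map_neg, map_smul, LinearMap.neg_apply, LinearMap.smul_apply, smul_eq_mul] at h1
  have h2 : ((a + b : ℝ) : ℂ) * killingForm ℂ 𝔤 x y = 0 := by
    push_cast
    linear_combination -h1
  exact (mul_eq_zero.1 h2).resolve_left (by exact_mod_cast h)

theorem induction_of_isHyperbolic (hH : IsHyperbolic H) {p : 𝔤 → Prop}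
    (h : ∀ r : ℝ, ∀ x ∈ Module.End.eigenspace (LieAlgebra.ad ℂ 𝔤 H) (r : ℂ), p x) (h0 : p 0)
    (hadd : ∀ x y, p x → p y → p (x + y)) (x : 𝔤) : p x :=
  Submodule.iSup_induction (fun r : ℝ => Module.End.eigenspace (LieAlgebra.ad ℂ 𝔤 H) (r : ℂ)) (motive := p)
    (by rw [show (⨆ r : ℝ, Module.End.eigenspace (LieAlgebra.ad ℂ 𝔤 H) (r : ℂ)) = ⊤ from hH]; trivial)
    h h0 hadd

theorem lie_levi_mem_eigenSum {S : Set ℝ} {x u : 𝔤}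
    (hx : x ∈ eigenSum (LieAlgebra.ad ℂ 𝔤 H) S) (hu : u ∈ levi H) :
    ⁅u, x⁆ ∈ eigenSum (LieAlgebra.ad ℂ 𝔤 H) S := by
  refine eigenSum_mapsTo (LieAlgebra.ad ℂ 𝔤 u) (fun y => ?_) hx
  rw [LieAlgebra.ad_apply, LieAlgebra.ad_apply, LieAlgebra.ad_apply, LieAlgebra.ad_apply,
    leibniz_lie H u y, mem_levi.1 hu]
  simp

theorem lie_mem_nPos_of_mem_eigenspace {a b : ℝ} (h : 0 < a + b) {x y : 𝔤}
    (hx : x ∈ Module.End.eigenspace (LieAlgebra.ad ℂ 𝔤 H) (a : ℂ))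
    (hy : y ∈ Module.End.eigenspace (LieAlgebra.ad ℂ 𝔤 H) (b : ℂ)) : ⁅x, y⁆ ∈ nPos H :=
  mem_eigenSum_of_mem (S := {r | 0 < r}) h (lie_mem_eigenspace hx hy)

variable [FiniteDimensional ℂ 𝔤]

/-- Each application of ad z shifts the ad H-eigenvalue by c ≠ 0. In finite dimension there are
finitely many eigenvalues, so every eigenvector is eventually killed, and the eigenvectors span. -/
theorem isNilpotent_ad_of_mem_eigenspace (hH : IsHyperbolic H) {c : ℝ} (hc : c ≠ 0) {z : 𝔤}
    (hz : z ∈ Module.End.eigenspace (LieAlgebra.ad ℂ 𝔤 H) (c : ℂ)) :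
    IsNilpotent (LieAlgebra.ad ℂ 𝔤 z) := by
  rw [Module.End.isNilpotent_iff_of_finite]
  refine induction_of_isHyperbolic hH ?_ ⟨0, by simp⟩ ?_
  · intro r x hx
    have hmem : ∀ n : ℕ, ((LieAlgebra.ad ℂ 𝔤 z) ^ n) x ∈
        Module.End.eigenspace (LieAlgebra.ad ℂ 𝔤 H) ((n * c + r : ℝ) : ℂ) := by
      intro n
      induction n with
      | zero => simpa using hx
      | succ n ih =>
        rw [pow_succ', Module.End.mul_apply, LieAlgebra.ad_apply]
        convert lie_mem_eigenspace hz ih using 3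
        push_cast
        ring
    by_contra! hne
    have hinj : Function.Injective fun n : ℕ => ((n * c + r : ℝ) : ℂ) := by
      intro n k hnk
      have h1 : (n : ℝ) * c + r = k * c + r := Complex.ofReal_injective hnk
      have h2 : (n : ℝ) * c = k * c := by linarith
      exact_mod_cast mul_right_cancel₀ hc h2
    refine Set.infinite_of_injective_forall_mem hinj (s := {μ | (LieAlgebra.ad ℂ 𝔤 H).HasEigenvalue μ})
      (fun n => ?_) (Module.End.finite_hasEigenvalue (LieAlgebra.ad ℂ 𝔤 H))
    exact Module.End.hasEigenvalue_of_hasEigenvector ⟨hmem n, hne n⟩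
  · rintro x y ⟨n, hn⟩ ⟨k, hk⟩
    refine ⟨n + k, ?_⟩
    rw [map_add]
    nth_rewrite 1 [add_comm n k]
    rw [pow_add, pow_add, Module.End.mul_apply, Module.End.mul_apply, hn, hk]
    simp

/-- If `[z, w]` commutes with `z` and `z` is an eigenvector of `ad H` with nonzero eigenvalue,
then `z` and `w` are orthogonal. -/
theorem killingForm_eq_zero_of_lie_lie_eq_zero (hH : IsHyperbolic H) {c : ℝ} (hc : c ≠ 0)
    {z w : 𝔤} (hz : z ∈ Module.End.eigenspace (LieAlgebra.ad ℂ 𝔤 H) (c : ℂ))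
    (hw : w ∈ Module.End.eigenspace (LieAlgebra.ad ℂ 𝔤 H) ((-c : ℝ) : ℂ))
    (h : ⁅z, ⁅z, w⁆⁆ = 0) : killingForm ℂ 𝔤 z w = 0 := by
  have hnil : IsNilpotent (LieAlgebra.ad ℂ 𝔤 ⁅z, w⁆) := by
    rw [LieHom.map_lie]
    apply isNilpotent_lie_of_lie_lie_eq_zero (isNilpotent_ad_of_mem_eigenspace hH hc hz)
    rw [← LieHom.map_lie, ← LieHom.map_lie, h, map_zero]
  have h0 : ⁅H, ⁅z, w⁆⁆ = 0 := by
    have := lie_mem_eigenspace hz hw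
    rw [Module.End.mem_eigenspace_iff, LieAlgebra.ad_apply] at this
    simpa using this
  have hcomm : Commute (LieAlgebra.ad ℂ 𝔤 H) (LieAlgebra.ad ℂ 𝔤 ⁅z, w⁆) := by
    rw [commute_iff_lie_eq, ← LieHom.map_lie, h0, map_zero]
  -- This is the trace of a product of commuting operators, one of them nilpotent. Invariance
  -- rewrites it as κ([H,z],w) = c·κ(z,w).
  have h1 : killingForm ℂ 𝔤 H ⁅z, w⁆ = 0 := by
    rw [killingForm_apply_apply]
    exact (LinearMap.isNilpotent_trace_of_isNilpotent (hcomm.isNilpotent_mul_left hnil)).eq_zero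
  rw [← LieModule.traceForm_apply_lie_apply] at h1
  rw [Module.End.mem_eigenspace_iff, LieAlgebra.ad_apply] at hz
  rw [hz, map_smul, LinearMap.smul_apply, smul_eq_zero] at h1
  exact h1.resolve_left (by exact_mod_cast hc)

variable [LieAlgebra.HasCentralRadical ℂ 𝔤]

/-- The radical of the Killing form of a reductive Lie algebra is contained in the center. -/
theorem lie_eq_zero_of_killingForm_eq_zero {x : 𝔤} (hx : ∀ y, killingForm ℂ 𝔤 x y = 0) (y : 𝔤) :
    ⁅y, x⁆ = 0 := by
  have h1 : x ∈ LieIdeal.killingCompl ℂ 𝔤 ⊤ := by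
    rw [LieIdeal.mem_killingCompl]
    intro z _
    rw [LieModule.traceForm_comm]
    exact hx z
  have h2 := LieAlgebra.killingCompl_top_le_radical ℂ 𝔤 h1
  rw [LieAlgebra.HasCentralRadical.radical_eq_center] at h2
  exact (LieModule.mem_maxTrivSubmodule ℂ 𝔤 𝔤 x).1 h2 y

/-- Orthogonality to the opposite eigenspace is orthogonality to all of 𝔤. Then `x` is central, so
a·x = [H,x] = 0. -/
theorem eq_zero_of_mem_eigenspace (hH : IsHyperbolic H) {a : ℝ} (ha : a ≠ 0) {x : 𝔤}
    (hx : x ∈ Module.End.eigenspace (LieAlgebra.ad ℂ 𝔤 H) (a : ℂ))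
    (h : ∀ y ∈ Module.End.eigenspace (LieAlgebra.ad ℂ 𝔤 H) ((-a : ℝ) : ℂ),
      killingForm ℂ 𝔤 x y = 0) : x = 0 := by
  have h1 : ∀ y, killingForm ℂ 𝔤 x y = 0 := by
    refine induction_of_isHyperbolic hH ?_ (by simp) (fun y z hy hz => by simp [hy, hz])
    intro r y hy
    by_cases hr : a + r = 0
    · obtain rfl : r = -a := by linarith
      exact h y hy
    · exact killingForm_eq_zero_of_add_ne_zero hx hy hr
  have h2 := lie_eq_zero_of_killingForm_eq_zero h1 H
  rw [Module.End.mem_eigenspace_iff, LieAlgebra.ad_apply, h2, eq_comm, smul_eq_zero] at hx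
  exact hx.resolve_left (by exact_mod_cast ha)

/-- The same argument without a single eigenvalue: a central element lies in the zero eigenspace,
which is independent of the eigenspaces indexed by `S`. -/
theorem eq_zero_of_mem_eigenSum (hH : IsHyperbolic H) {S : Set ℝ} (hS : (0 : ℝ) ∉ S) {x : 𝔤}
    (hx : x ∈ eigenSum (LieAlgebra.ad ℂ 𝔤 H) S)
    (h : ∀ r ∈ S, ∀ y ∈ Module.End.eigenspace (LieAlgebra.ad ℂ 𝔤 H) ((-r : ℝ) : ℂ),
      killingForm ℂ 𝔤 x y = 0) : x = 0 := by
  have h1 : ∀ y, killingForm ℂ 𝔤 x y = 0 := by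
    refine induction_of_isHyperbolic hH ?_ (by simp) (fun y z hy hz => by simp [hy, hz])
    intro r y hy
    by_cases hr : -r ∈ S
    · exact h _ hr y (by simpa using hy)
    · refine eigenSum_induction (p := fun x => killingForm ℂ 𝔤 x y = 0) ?_ (by simp)
        (fun x z hx hz => by simp [hx, hz]) hx
      intro s hs x hx
      refine killingForm_eq_zero_of_add_ne_zero hx hy ?_
      intro h0
      exact hr (by rwa [show -r = s by linarith])
  have h2 := lie_eq_zero_of_killingForm_eq_zero h1 H
  have h3 : x ∈ eigenSum (LieAlgebra.ad ℂ 𝔤 H) {0} := by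
    rw [← eigenspace_eq_eigenSum, Module.End.mem_eigenspace_iff, LieAlgebra.ad_apply, h2]
    simp
  exact (Submodule.disjoint_def.1 (disjoint_eigenSum _ (by simpa using hS))) x hx h3

theorem eq_zero_of_mem_nNeg (hH : IsHyperbolic H) {x : 𝔤} (hx : x ∈ nNeg H)
    (h : ∀ y ∈ nPos H, killingForm ℂ 𝔤 x y = 0) : x = 0 :=
  eq_zero_of_mem_eigenSum (S := {r | r < 0}) hH (by simp) hx fun r hr y hy =>
    h y (mem_eigenSum_of_mem (S := {r | 0 < r}) (r := -r) (by simpa using hr) hy)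

theorem eq_zero_of_mem_nPos (hH : IsHyperbolic H) {x : 𝔤} (hx : x ∈ nPos H)
    (h : ∀ y ∈ nNeg H, killingForm ℂ 𝔤 x y = 0) : x = 0 :=
  eq_zero_of_mem_eigenSum (S := {r | 0 < r}) hH (by simp) hx fun r hr y hy =>
    h y (mem_eigenSum_of_mem (S := {r | r < 0}) (r := -r) (by simpa using hr) hy)

/-- For eigenvectors x, y with negative eigenvalues a, b, it suffices that w = [x,y] is orthogonal
to each z of eigenvalue -(a+b). Bracketing z with x or y still lands in 𝔫₊, because -b and -a are
positive. Since 𝔫₊ is abelian this forces [z,[z,w]] = 0, and the nilpotency criterion gives κ(z,w) =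
0. -/
theorem lie_eq_zero_of_mem_nNeg (hH : IsHyperbolic H)
    (hab : ∀ Y ∈ nPos H, ∀ Z ∈ nPos H, ⁅Y, Z⁆ = 0) {x y : 𝔤} (hx : x ∈ nNeg H)
    (hy : y ∈ nNeg H) : ⁅x, y⁆ = 0 := by
  refine eigenSum_induction (S := {r | r < 0}) (p := fun x => ⁅x, y⁆ = 0) ?_ (by simp)
    (fun x z hx hz => by simp [hx, hz]) hx
  intro a ha x hx
  refine eigenSum_induction (S := {r | r < 0}) (p := fun y => ⁅x, y⁆ = 0) ?_ (by simp)
    (fun x z hx hz => by simp [hx, hz]) hy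
  intro b hb y hy
  simp only [Set.mem_ofPred_eq] at ha hb
  have hw := lie_mem_eigenspace hx hy
  refine eq_zero_of_mem_eigenspace hH (by linarith) hw ?_
  intro z hz
  rw [LieModule.traceForm_comm]
  refine killingForm_eq_zero_of_lie_lie_eq_zero hH (c := -(a + b)) (by linarith) hz
    (by simpa using hw) ?_
  have hzp : z ∈ nPos H := mem_eigenSum_of_mem (S := {r | 0 < r}) (by simp; linarith) hz
  have hzx : ⁅z, x⁆ ∈ nPos H := lie_mem_nPos_of_mem_eigenspace (by linarith) hz hx
  have hzy : ⁅z, y⁆ ∈ nPos H := lie_mem_nPos_of_mem_eigenspace (by linarith) hz hy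
  -- Expanding [z,[z,[x,y]]] by Leibniz, every term contains a bracket of two elements of 𝔫₊.
  rw [leibniz_lie z x y, lie_add, leibniz_lie z _ y, leibniz_lie z x _, hab z hzp _ hzx,
    hab _ hzx _ hzy, hab z hzp _ hzy]
  simp

/-- A component of [x,y] of nonzero eigenvalue pairs only with z of the opposite eigenvalue. That z
lies in 𝔫₊ or 𝔫₋, so invariance moves it into a vanishing bracket with y or with x. -/
theorem lie_mem_levi (hH : IsHyperbolic H)
    (hab : ∀ Y ∈ nPos H, ∀ Z ∈ nPos H, ⁅Y, Z⁆ = 0) {x y : 𝔤} (hx : x ∈ nNeg H)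
    (hy : y ∈ nPos H) : ⁅x, y⁆ ∈ levi H := by
  refine eigenSum_induction (S := {r | r < 0}) (p := fun x => ⁅x, y⁆ ∈ levi H) ?_ (by simp)
    (fun x z hx hz => by rw [add_lie]; exact add_mem hx hz) hx
  intro a ha x hx
  refine eigenSum_induction (S := {r | 0 < r}) (p := fun y => ⁅x, y⁆ ∈ levi H) ?_ (by simp)
    (fun x z hx hz => by rw [lie_add]; exact add_mem hx hz) hy
  intro b hb y hy
  simp only [Set.mem_ofPred_eq] at ha hb
  have hw := lie_mem_eigenspace hx hy
  by_cases hab0 : a + b = 0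
  · rw [hab0, Module.End.mem_eigenspace_iff, LieAlgebra.ad_apply] at hw
    rw [mem_levi, hw]
    simp
  rw [eq_zero_of_mem_eigenspace hH hab0 hw]
  · exact zero_mem _
  intro z hz
  have hxn : x ∈ nNeg H := mem_eigenSum_of_mem (S := {r | r < 0}) ha hx
  have hyp : y ∈ nPos H := mem_eigenSum_of_mem (S := {r | 0 < r}) hb hy
  rcases lt_or_gt_of_ne hab0 with h | h
  · rw [LieModule.traceForm_apply_lie_apply, hab y hyp z
      (mem_eigenSum_of_mem (S := {r | 0 < r}) (by simp; linarith) hz), map_zero]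
  · rw [← lie_skew, map_neg, LinearMap.neg_apply, LieModule.traceForm_apply_lie_apply,
      lie_eq_zero_of_mem_nNeg hH hab hxn
        (mem_eigenSum_of_mem (S := {r | r < 0}) (r := -(a + b)) (by simp; linarith) hz), map_zero,
      neg_zero]

end Structure

end FMethod

namespace FMethod

/-! ### Integrating the infinitesimal Gelfand–Naimark decomposition -/

section Flow

variable {A : Type*} [NormedRing A] [NormedAlgebra ℝ A] [CompleteSpace A]

theorem eq_of_hasDerivAt_zero {E : Type*} [NormedAddCommGroup E] [NormedSpace ℝ E] {f : ℝ → E}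
    {s : Set ℝ} (hs : IsOpen s) (hs' : IsPreconnected s) (hf : ∀ t ∈ s, HasDerivAt f 0 t)
    {t₀ t : ℝ} (ht₀ : t₀ ∈ s) (ht : t ∈ s) : f t = f t₀ :=
  hs.is_const_of_deriv_eq_zero hs'
    (fun x hx => (hf x hx).differentiableAt.differentiableWithinAt)
    (fun x hx => (hf x hx).deriv) ht ht₀

theorem hasDerivAt_prod_fst {E F : Type*} [NormedAddCommGroup E] [NormedSpace ℝ E]
    [NormedAddCommGroup F] [NormedSpace ℝ F] {p : ℝ → E × F} {p' : E × F} {t : ℝ}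
    (h : HasDerivAt p p' t) : HasDerivAt (fun t => (p t).1) p'.1 t :=
  (ContinuousLinearMap.fst ℝ E F).hasFDerivAt.comp_hasDerivAt t h

theorem hasDerivAt_prod_snd {E F : Type*} [NormedAddCommGroup E] [NormedSpace ℝ E]
    [NormedAddCommGroup F] [NormedSpace ℝ F] {p : ℝ → E × F} {p' : E × F} {t : ℝ}
    (h : HasDerivAt p p' t) : HasDerivAt (fun t => (p t).2) p'.2 t :=
  (ContinuousLinearMap.snd ℝ E F).hasFDerivAt.comp_hasDerivAt t h

/-- Commutativity factors exp(x s) as exp(x t)·exp(x s - x t), so only the derivative of exp at 0 is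
needed. -/
theorem hasDerivAt_exp_of_commute {x : ℝ → A} {x' : A} {t : ℝ} (hx : HasDerivAt x x' t)
    (hc : ∀ s r, Commute (x s) (x r)) :
    HasDerivAt (fun s => NormedSpace.exp (x s)) (NormedSpace.exp (x t) * x') t := by
  let _ : NormedAlgebra ℚ A := NormedAlgebra.restrictScalars ℚ ℝ A
  have h1 : (fun s => NormedSpace.exp (x s)) =
      fun s => NormedSpace.exp (x t) * NormedSpace.exp (x s - x t) := by
    funext s
    rw [← NormedSpace.exp_add_of_commute]
    · congr 1
      abel
    · exact (hc t s).sub_right (hc t t)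
  rw [h1]
  have h2 : HasDerivAt (fun s => NormedSpace.exp (x s - x t)) x' t := by
    have h3 : HasFDerivAt (NormedSpace.exp : A → A) (1 : A →L[ℝ] A) (x t - x t) := by
      rw [sub_self]
      exact hasFDerivAt_exp_zero
    exact h3.comp_hasDerivAt t (hx.sub_const (x t))
  exact h2.const_mul (NormedSpace.exp (x t))

theorem exp_mul_exp_neg (x : A) : NormedSpace.exp x * NormedSpace.exp (-x) = 1 := by
  let _ : NormedAlgebra ℚ A := NormedAlgebra.restrictScalars ℚ ℝ A
  rw [← NormedSpace.exp_add_of_commute (Commute.neg_right (Commute.refl x)), add_neg_cancel,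
    NormedSpace.exp_zero]

theorem exp_neg_mul_exp (x : A) : NormedSpace.exp (-x) * NormedSpace.exp x = 1 := by
  simpa using exp_mul_exp_neg (-x)

/-- Conjugation by `exp x` of an element which is annihilated by `(ad x) ^ 3`. -/
theorem mul_exp_eq_of_lie_eq_zero {x y c d : A} (hc : x * y - y * x = c) (hd : x * c - c * x = d)
    (h0 : x * d = d * x) :
    y * NormedSpace.exp x = NormedSpace.exp x * (y - c + (2⁻¹ : ℝ) • d) := by
  -- The quadratic polynomial in s is the candidate for exp(-s x)·y·exp(s x). Conjugating it back
  -- gives a constant curve, compared below at s = 0 and s = 1.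
  have key : ∀ s : ℝ, HasDerivAt (fun s : ℝ => NormedSpace.exp (s • x) *
      (y - s • c + (2⁻¹ * (s * s)) • d) * NormedSpace.exp (s • (-x))) 0 s := by
    intro s
    have h1 := hasDerivAt_exp_smul_const x s
    have h2 := hasDerivAt_exp_smul_const' (-x) s
    have h3 : HasDerivAt (fun s : ℝ => y - s • c + (2⁻¹ * (s * s)) • d) (- c + s • d) s := by
      have h4 := (((hasDerivAt_id s).smul_const c).const_sub y).add
        ((((hasDerivAt_id s).mul (hasDerivAt_id s)).const_mul (2⁻¹ : ℝ)).smul_const d)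
      refine h4.congr_deriv ?_
      simp only [id, one_smul, mul_one, one_mul]
      module
    refine ((h1.mul h3).mul h2).congr_deriv ?_
    simp only [Pi.mul_apply]
    have : x * (y - s • c + (2⁻¹ * (s * s)) • d) + (-c + s • d) +
        (y - s • c + (2⁻¹ * (s * s)) • d) * (-x) = 0 := by
      have e1 : y * x = x * y - c := by rw [← hc]; abel
      have e2 : c * x = x * c - d := by rw [← hd]; abel
      simp only [mul_add, mul_sub, add_mul, sub_mul, mul_neg, mul_smul_comm, smul_mul_assoc, e1, e2,
        h0]
      module
    symm
    calc (0 : A) = NormedSpace.exp (s • x) * (x * (y - s • c + (2⁻¹ * (s * s)) • d) +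
        (-c + s • d) + (y - s • c + (2⁻¹ * (s * s)) • d) * (-x)) * NormedSpace.exp (s • (-x)) := by
          rw [this]; simp
      _ = _ := by noncomm_ring
  have h := eq_of_hasDerivAt_zero isOpen_univ isPreconnected_univ (fun t _ => key t)
    (Set.mem_univ 0) (Set.mem_univ 1)
  simp only [one_smul, zero_smul, mul_zero, mul_one, sub_zero, add_zero, NormedSpace.exp_zero,
    one_mul] at h
  conv_lhs => rw [← h]
  rw [mul_assoc, exp_neg_mul_exp, mul_one]

/-- The decomposition `exp (t y) exp (J₋ u₀) = exp (J₋ (u t)) * l t * exp (J₊ (w t))` for small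
`t`, obtained by integrating its infinitesimal version. -/
theorem exists_decomposition_curve [IsDedekindFiniteMonoid A]
    {U W : Type*} [NormedAddCommGroup U] [NormedSpace ℝ U] [CompleteSpace U]
    [NormedAddCommGroup W] [NormedSpace ℝ W] [FiniteDimensional ℝ W]
    (Jm : U →L[ℝ] A) (Jp : W →L[ℝ] A) (α : U →L[ℝ] A) (Γ : U →L[ℝ] W →L[ℝ] W) {B : U → U}
    (hB : ContDiff ℝ 1 B) (v₀ : W) (u₀ : U)
    (hm : ∀ u v, Commute (Jm u) (Jm v)) (hp : ∀ u v, Commute (Jp u) (Jp v))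
    (hconj : ∀ u, Jp v₀ * NormedSpace.exp (Jm u) =
      NormedSpace.exp (Jm u) * (Jp v₀ + α u + Jm (B u)))
    (hΓ : ∀ u v, α u * Jp v - Jp v * α u = Jp (Γ u v)) :
    ∃ (u : ℝ → U) (l k : ℝ → A) (w : ℝ → W), u 0 = u₀ ∧ l 0 = 1 ∧
      HasDerivAt u (B u₀) 0 ∧ HasDerivAt l (α u₀) 0 ∧
      ∀ᶠ t in 𝓝 (0 : ℝ), l t * k t = 1 ∧ k t * l t = 1 ∧
        (∀ h, (∀ u, Commute h (α u)) → Commute h (l t)) ∧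
        NormedSpace.exp (t • Jp v₀) * NormedSpace.exp (Jm u₀) =
          NormedSpace.exp (Jm (u t)) * l t * NormedSpace.exp (Jp (w t)) := by
  have : CompleteSpace W := FiniteDimensional.complete ℝ W
  -- The unknowns are (u, φ, ψ, w, l, k). Here u follows `B`, l integrates α along u, and φ
  -- integrates the bracket with α on 𝔫₊, so it will be Ad(l). The unknowns k and ψ are to be l⁻¹
  -- and φ⁻¹; carrying them along avoids inversion in the vector field. Finally w moves with
  -- velocity Ad(l⁻¹)v₀.
  let Φ : U × (W →L[ℝ] W) × (W →L[ℝ] W) × W × A × A → U × (W →L[ℝ] W) × (W →L[ℝ] W) × W × A × A :=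
    fun p => (B p.1, Γ p.1 * p.2.1, - (p.2.2.1 * Γ p.1), p.2.2.1 v₀,
      α p.1 * p.2.2.2.2.1, - (p.2.2.2.2.2 * α p.1))
  have hΦ : ContDiff ℝ 1 Φ := by
    have h1 : ContDiff ℝ 1 fun p : U × (W →L[ℝ] W) × (W →L[ℝ] W) × W × A × A => Γ p.1 :=
      Γ.contDiff.comp contDiff_fst
    have h2 : ContDiff ℝ 1 fun p : U × (W →L[ℝ] W) × (W →L[ℝ] W) × W × A × A => α p.1 :=
      α.contDiff.comp contDiff_fst
    refine (hB.comp contDiff_fst).prodMk ((h1.mul (by fun_prop)).prodMk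
      (((ContDiff.mul (by fun_prop) h1).neg).prodMk (ContDiff.prodMk (by fun_prop)
      ((h2.mul (by fun_prop)).prodMk ((ContDiff.mul (by fun_prop) h2).neg)))))
  obtain ⟨p, hp0, ε, hε, hder⟩ :=
    (hΦ.contDiffAt (x := (u₀, 1, 1, 0, 1, 1))).exists_forall_mem_closedBall_exists_eq_forall_mem_Ioo_hasDerivAt₀
      (0 : ℝ)
  simp only [zero_sub, zero_add] at hder
  set I := Set.Ioo (-ε) ε with hI
  have h0I : (0 : ℝ) ∈ I := by simp [hI, hε]
  have hIo : IsOpen I := isOpen_Ioo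
  have hIp : IsPreconnected I := isPreconnected_Ioo
  have hu : ∀ t ∈ I, HasDerivAt (fun t => (p t).1) (B (p t).1) t := fun t ht =>
    hasDerivAt_prod_fst (hder t ht)
  have h2 : ∀ t ∈ I, HasDerivAt (fun t => (p t).2) (Φ (p t)).2 t := fun t ht =>
    hasDerivAt_prod_snd (hder t ht)
  have hφ : ∀ t ∈ I, HasDerivAt (fun t => (p t).2.1) (Γ (p t).1 * (p t).2.1) t := fun t ht =>
    hasDerivAt_prod_fst (h2 t ht)
  have h3 : ∀ t ∈ I, HasDerivAt (fun t => (p t).2.2) (Φ (p t)).2.2 t := fun t ht =>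
    hasDerivAt_prod_snd (h2 t ht)
  have hψ : ∀ t ∈ I, HasDerivAt (fun t => (p t).2.2.1) (-((p t).2.2.1 * Γ (p t).1)) t := fun t ht =>
    hasDerivAt_prod_fst (h3 t ht)
  have h4 : ∀ t ∈ I, HasDerivAt (fun t => (p t).2.2.2) (Φ (p t)).2.2.2 t := fun t ht =>
    hasDerivAt_prod_snd (h3 t ht)
  have hw : ∀ t ∈ I, HasDerivAt (fun t => (p t).2.2.2.1) ((p t).2.2.1 v₀) t := fun t ht =>
    hasDerivAt_prod_fst (h4 t ht)
  have h5 : ∀ t ∈ I, HasDerivAt (fun t => (p t).2.2.2.2) (Φ (p t)).2.2.2.2 t := fun t ht =>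
    hasDerivAt_prod_snd (h4 t ht)
  have hl : ∀ t ∈ I, HasDerivAt (fun t => (p t).2.2.2.2.1) (α (p t).1 * (p t).2.2.2.2.1) t :=
    fun t ht => hasDerivAt_prod_fst (h5 t ht)
  have hk : ∀ t ∈ I, HasDerivAt (fun t => (p t).2.2.2.2.2) (-((p t).2.2.2.2.2 * α (p t).1)) t :=
    fun t ht => hasDerivAt_prod_snd (h5 t ht)
  clear_value Φ
  generalize hue : (fun t => (p t).1) = u at *
  generalize hφe : (fun t => (p t).2.1) = φ at *
  generalize hψe : (fun t => (p t).2.2.1) = ψ at *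
  generalize hwe : (fun t => (p t).2.2.2.1) = w at *
  generalize hle : (fun t => (p t).2.2.2.2.1) = l at *
  generalize hke : (fun t => (p t).2.2.2.2.2) = k at *
  simp only [fun t => congrFun hue t, fun t => congrFun hφe t, fun t => congrFun hψe t,
    fun t => congrFun hle t, fun t => congrFun hke t] at hu hφ hψ hw hl hk
  have hu0 : u 0 = u₀ := by rw [← hue]; simp [hp0]
  have hφ0 : φ 0 = 1 := by rw [← hφe]; simp [hp0]
  have hψ0 : ψ 0 = 1 := by rw [← hψe]; simp [hp0]
  have hw0 : w 0 = 0 := by rw [← hwe]; simp [hp0]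
  have hl0 : l 0 = 1 := by rw [← hle]; simp [hp0]
  have hk0 : k 0 = 1 := by rw [← hke]; simp [hp0]
  have hkl : ∀ t ∈ I, k t * l t = 1 := by
    intro t ht
    have := eq_of_hasDerivAt_zero hIo hIp (f := fun t => k t * l t) (fun t ht => by
      refine ((hk t ht).mul (hl t ht)).congr_deriv ?_; noncomm_ring) h0I ht
    simpa [hk0, hl0] using this
  -- Only the product k·l has a visibly vanishing derivative; the other order comes from Dedekind
  -- finiteness. The same is done for φ and ψ through finite dimensionality of W.
  have hlk : ∀ t ∈ I, l t * k t = 1 := fun t ht => mul_eq_one_symm (hkl t ht)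
  have hψφ : ∀ t ∈ I, ψ t * φ t = 1 := by
    intro t ht
    have := eq_of_hasDerivAt_zero hIo hIp (f := fun t => ψ t * φ t) (fun t ht => by
      refine ((hψ t ht).mul (hφ t ht)).congr_deriv ?_; noncomm_ring) h0I ht
    simpa [hψ0, hφ0] using this
  have hφψ : ∀ t ∈ I, φ t * ψ t = 1 := by
    intro t ht
    have h6 : ((ψ t : W →L[ℝ] W) : W →ₗ[ℝ] W) * ((φ t : W →L[ℝ] W) : W →ₗ[ℝ] W) = 1 := by
      have := congrArg (fun f : W →L[ℝ] W => (f : W →ₗ[ℝ] W)) (hψφ t ht)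
      exact this
    have h7 := mul_eq_one_symm h6
    ext v
    exact LinearMap.congr_fun h7 v
  -- This identifies φ t with Ad(l t) on the image of `Jp`; `hΓ` makes the derivative cancel.
  have hJ : ∀ v, ∀ t ∈ I, k t * Jp (φ t v) * l t = Jp v := by
    intro v t ht
    have := eq_of_hasDerivAt_zero hIo hIp (f := fun t => k t * Jp (φ t v) * l t) (fun t ht => by
      have h6 : HasDerivAt (fun t => φ t v) ((Γ (u t) * φ t) v) t :=
        (ContinuousLinearMap.apply ℝ W v).hasFDerivAt.comp_hasDerivAt t (hφ t ht)
      have h7 : HasDerivAt (fun t => Jp (φ t v)) (Jp ((Γ (u t) * φ t) v)) t :=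
        Jp.hasFDerivAt.comp_hasDerivAt t h6
      refine (((hk t ht).mul h7).mul (hl t ht)).congr_deriv ?_
      rw [mul_apply_eq_comp, ← hΓ]
      simp only [Pi.mul_apply]
      noncomm_ring) h0I ht
    simpa [hk0, hl0, hφ0] using this
  have hcom : ∀ h, (∀ u, Commute h (α u)) → ∀ t ∈ I, Commute h (l t) := by
    intro h hh t ht
    have h6 := eq_of_hasDerivAt_zero hIo hIp (f := fun t => k t * h * l t) (fun t ht => by
      refine (((hk t ht).mul_const h).mul (hl t ht)).congr_deriv ?_
      rw [neg_mul, mul_assoc (k t), ← (hh (u t)).eq]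
      noncomm_ring) h0I ht
    simp only [hk0, hl0, one_mul, mul_one] at h6
    have h7 : l t * (k t * h * l t) = h * l t := by
      rw [mul_assoc, ← mul_assoc (l t), hlk t ht, one_mul]
    rw [h6] at h7
    exact h7.symm
  -- The derivative vanishes: `hconj` cancels the velocities of u and l against two of the three
  -- terms of Ad(exp(-u))v₀. The remaining term cancels against the velocity of w, because v₀·l =
  -- l·Ad(l⁻¹)v₀.
  have hmain : ∀ t ∈ I, NormedSpace.exp (t • -Jp v₀) * NormedSpace.exp (Jm (u t)) * l t *
      NormedSpace.exp (Jp (w t)) = NormedSpace.exp (Jm u₀) := by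
    intro t ht
    have := eq_of_hasDerivAt_zero hIo hIp (f := fun t => NormedSpace.exp (t • -Jp v₀) *
        NormedSpace.exp (Jm (u t)) * l t * NormedSpace.exp (Jp (w t))) (fun t ht => by
      have h6 := hasDerivAt_exp_smul_const (-Jp v₀) t
      have h7 := hasDerivAt_exp_of_commute (Jm.hasFDerivAt.comp_hasDerivAt t (hu t ht))
        (fun s r => hm _ _)
      have h8 := hasDerivAt_exp_of_commute (Jp.hasFDerivAt.comp_hasDerivAt t (hw t ht))
        (fun s r => hp _ _)
      have h9 : Jp v₀ * l t = l t * Jp (ψ t v₀) := by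
        have h10 := hJ (ψ t v₀) t ht
        have h11 : φ t (ψ t v₀) = v₀ := congrArg (fun f : W →L[ℝ] W => f v₀) (hφψ t ht)
        rw [← h10, h11, ← mul_assoc, ← mul_assoc, hlk t ht, one_mul]
      have h12 : NormedSpace.exp (Jp (w t)) * Jp (ψ t v₀) =
          Jp (ψ t v₀) * NormedSpace.exp (Jp (w t)) := by
        let _ : NormedAlgebra ℚ A := NormedAlgebra.restrictScalars ℚ ℝ A
        exact ((hp (w t) (ψ t v₀)).exp_left).eq
      have h13 := hconj (u t)
      simp only [Function.comp_apply] at h7 h8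
      refine (((h6.mul h7).mul (hl t ht)).mul h8).congr_deriv ?_
      simp only [Pi.mul_apply]
      rw [h12, mul_assoc (NormedSpace.exp (t • -Jp v₀)) (-Jp v₀), neg_mul, h13]
      generalize NormedSpace.exp (t • -Jp v₀) = a at *
      generalize NormedSpace.exp (Jm (u t)) = b at *
      generalize NormedSpace.exp (Jp (w t)) = c at *
      rw [← mul_assoc _ (Jp (ψ t v₀)) c, mul_assoc _ (l t) (Jp (ψ t v₀)), ← h9]
      noncomm_ring) h0I ht
    simpa [hu0, hl0, hw0, NormedSpace.exp_zero] using this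
  refine ⟨u, l, k, w, hu0, hl0, by simpa [hu0] using hu 0 h0I, by simpa [hu0, hl0] using hl 0 h0I, ?_⟩
  filter_upwards [hIo.mem_nhds h0I] with t ht
  refine ⟨hlk t ht, hkl t ht, fun h hh => hcom h hh t ht, ?_⟩
  rw [← hmain t ht, smul_neg]
  simp only [← mul_assoc]
  rw [exp_mul_exp_neg, one_mul]

end Flow

end FMethod

namespace FMethod

/-! ### Exponentials of matrices -/

section MatrixExp

variable {m : Type*} [Fintype m]

/-- Derivatives of matrix curves depend only on the topology; a norm on matrices is chosen only
inside proofs. -/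
theorem matrix_hasDerivAt_congr {f g : ℝ → Matrix m m ℂ} {f' : Matrix m m ℂ} {t : ℝ}
    (h : HasDerivAt f f' t) (hfg : g =ᶠ[𝓝 t] f) : HasDerivAt g f' t := by
  open scoped Matrix.Norms.Operator in exact HasDerivAt.congr_of_eventuallyEq h hfg

theorem matrix_hasDerivAt_unique {f : ℝ → Matrix m m ℂ} {a b : Matrix m m ℂ} {t : ℝ}
    (ha : HasDerivAt f a t) (hb : HasDerivAt f b t) : a = b := by
  open scoped Matrix.Norms.Operator in exact HasDerivAt.unique ha hb

variable [DecidableEq m]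

theorem matrix_exp_mul_exp_neg (x : Matrix m m ℂ) :
    NormedSpace.exp x * NormedSpace.exp (-x) = 1 := by
  open scoped Matrix.Norms.Operator in exact exp_mul_exp_neg x

theorem matrix_exp_neg_mul_exp (x : Matrix m m ℂ) :
    NormedSpace.exp (-x) * NormedSpace.exp x = 1 := by
  open scoped Matrix.Norms.Operator in exact exp_neg_mul_exp x

theorem matrix_mul_exp_eq_of_lie_eq_zero {x y c d : Matrix m m ℂ} (hc : x * y - y * x = c)
    (hd : x * c - c * x = d) (h0 : x * d = d * x) :
    y * NormedSpace.exp x = NormedSpace.exp x * (y - c + (2⁻¹ : ℝ) • d) := by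
  open scoped Matrix.Norms.Operator in exact mul_exp_eq_of_lie_eq_zero hc hd h0

/-- Coordinate spaces supply the norms that 𝔫₋ and 𝔫₊ lack, and finite dimension makes all linear
and bilinear data continuous. -/
theorem matrix_exists_decomposition_curve {ι ι' : Type*} [Fintype ι] [Fintype ι']
    (Jm : (ι → ℂ) →ₗ[ℝ] Matrix m m ℂ) (Jp : (ι' → ℂ) →ₗ[ℝ] Matrix m m ℂ)
    (α : (ι → ℂ) →ₗ[ℝ] Matrix m m ℂ) (Γ : (ι → ℂ) →ₗ[ℝ] (ι' → ℂ) →ₗ[ℝ] (ι' → ℂ))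
    (β : (ι → ℂ) →ₗ[ℝ] (ι → ℂ) →ₗ[ℝ] (ι → ℂ)) (v₀ : ι' → ℂ) (u₀ : ι → ℂ)
    (hm : ∀ u v, Commute (Jm u) (Jm v)) (hp : ∀ u v, Commute (Jp u) (Jp v))
    (hconj : ∀ u, Jp v₀ * NormedSpace.exp (Jm u) =
      NormedSpace.exp (Jm u) * (Jp v₀ + α u + Jm (β u u)))
    (hΓ : ∀ u v, α u * Jp v - Jp v * α u = Jp (Γ u v)) :
    ∃ (u : ℝ → ι → ℂ) (l k : ℝ → Matrix m m ℂ) (w : ℝ → ι' → ℂ),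
      HasDerivAt (fun t => Jm (u t)) (Jm (β u₀ u₀)) 0 ∧ HasDerivAt l (α u₀) 0 ∧
      ∀ᶠ t in 𝓝 (0 : ℝ), l t * k t = 1 ∧ k t * l t = 1 ∧
        (∀ h, (∀ u, Commute h (α u)) → Commute h (l t)) ∧
        NormedSpace.exp (t • Jp v₀) * NormedSpace.exp (Jm u₀) =
          NormedSpace.exp (Jm (u t)) * l t * NormedSpace.exp (Jp (w t)) := by
  open scoped Matrix.Norms.Operator in
  have hB : ContDiff ℝ 1 (fun u => β.toContinuousBilinearMap u u) :=
    β.toContinuousBilinearMap.contDiff.clm_apply contDiff_id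
  obtain ⟨u, l, k, w, hu0, hl0, hu', hl', hev⟩ := exists_decomposition_curve
    Jm.toContinuousLinearMap Jp.toContinuousLinearMap α.toContinuousLinearMap
    Γ.toContinuousBilinearMap hB v₀ u₀ hm hp hconj hΓ
  exact ⟨u, l, k, w, Jm.toContinuousLinearMap.hasFDerivAt.comp_hasDerivAt (0 : ℝ) hu', hl', hev⟩

end MatrixExp

end FMethod

namespace FMethod

/-! ### The components of the Gelfand–Naimark decomposition -/

section Decomposition

variable {𝔤 : Type*} [LieRing 𝔤] [LieAlgebra ℂ 𝔤] {H : 𝔤}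

theorem lie_mem_eigenSum {S : Set ℝ} {x : 𝔤} (hx : x ∈ eigenSum (LieAlgebra.ad ℂ 𝔤 H) S) :
    ⁅H, x⁆ ∈ eigenSum (LieAlgebra.ad ℂ 𝔤 H) S :=
  lie_levi_mem_eigenSum hx (mem_levi.2 (lie_self H))

theorem eq_zero_of_mem_eigenSum_of_lie_eq_zero {S : Set ℝ} (hS : (0 : ℝ) ∉ S) {x : 𝔤}
    (hx : x ∈ eigenSum (LieAlgebra.ad ℂ 𝔤 H) S) (h : ⁅H, x⁆ = 0) : x = 0 := by
  have h3 : x ∈ eigenSum (LieAlgebra.ad ℂ 𝔤 H) {0} := by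
    rw [← eigenspace_eq_eigenSum, Module.End.mem_eigenspace_iff, LieAlgebra.ad_apply, h]
    simp
  exact (Submodule.disjoint_def.1 (disjoint_eigenSum _ (by simpa using hS))) x hx h3

theorem eq_zero_of_mem_nNeg_of_lie_eq_zero {x : 𝔤} (hx : x ∈ nNeg H) (h : ⁅H, x⁆ = 0) : x = 0 :=
  eq_zero_of_mem_eigenSum_of_lie_eq_zero (S := {r | r < 0}) (by simp) hx h

theorem eq_zero_of_mem_nPos_of_lie_eq_zero {x : 𝔤} (hx : x ∈ nPos H) (h : ⁅H, x⁆ = 0) : x = 0 :=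
  eq_zero_of_mem_eigenSum_of_lie_eq_zero (S := {r | 0 < r}) (by simp) hx h

variable {m : Type*} [Fintype m] [DecidableEq m] {j : 𝔤 →ₗ⁅ℂ⁆ Matrix m m ℂ}

theorem map_lie_eq (x y : 𝔤) : j x * j y - j y * j x = j ⁅x, y⁆ := by
  rw [LieHom.map_lie, Ring.lie_def]

theorem commute_map_of_lie_eq_zero {x y : 𝔤} (h : ⁅x, y⁆ = 0) : Commute (j x) (j y) := by
  rw [commute_iff_lie_eq, ← LieHom.map_lie, h, map_zero]

theorem map_mul_exp {x y : 𝔤} (h : ⁅x, ⁅x, y⁆⁆ = 0) :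
    j y * NormedSpace.exp (j x) = NormedSpace.exp (j x) * (j y - j ⁅x, y⁆) := by
  have := matrix_mul_exp_eq_of_lie_eq_zero (x := j x) (y := j y) (c := j ⁅x, y⁆) (d := 0) (map_lie_eq x y)
    (by rw [map_lie_eq, h, map_zero]) (by simp)
  rw [this]
  simp

theorem exp_map_sub {x y : 𝔤} (h : ⁅x, y⁆ = 0) :
    NormedSpace.exp (j (x - y)) = NormedSpace.exp (-j y) * NormedSpace.exp (j x) := by
  rw [← Matrix.exp_add_of_commute, map_sub]
  · congr 1
    abel
  · exact (commute_map_of_lie_eq_zero h).symm.neg_left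

theorem exp_map_sub' {x y : 𝔤} (h : ⁅x, y⁆ = 0) :
    NormedSpace.exp (j (x - y)) = NormedSpace.exp (j x) * NormedSpace.exp (-j y) := by
  rw [← Matrix.exp_add_of_commute, map_sub]
  · rw [sub_eq_add_neg]
  · exact (commute_map_of_lie_eq_zero h).neg_right

theorem commute_of_mem_leviGroup {g : (Matrix m m ℂ)ˣ} (hg : g ∈ leviGroup j H) :
    Commute (j H) (g : Matrix m m ℂ) := by
  have h := congrArg (fun a => a * (g : Matrix m m ℂ)) hg.2
  simp only [mul_assoc, Units.inv_mul, mul_one] at h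
  exact h.symm

/-- Move j(H) from left to right through both sides of `h`: it passes l and l' freely and picks up
one bracket at each exponential. Equate the two corrections. -/
theorem map_lie_mul_of_exp_mul_eq {ξ ζ : 𝔤} {l l' : Matrix m m ℂ} (hl : Commute (j H) l)
    (hl' : Commute (j H) l') (hξ : ⁅ξ, ⁅ξ, H⁆⁆ = 0) (hζ : ⁅ζ, ⁅ζ, H⁆⁆ = 0)
    (h : NormedSpace.exp (j ξ) * l = l' * NormedSpace.exp (j ζ)) :
    j ⁅ξ, H⁆ * l = l * j ⁅ζ, H⁆ := by
  have e2 := map_mul_exp (j := j) hξ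
  have e3 := map_mul_exp (j := j) hζ
  have e4 := matrix_exp_neg_mul_exp (j ξ)
  generalize NormedSpace.exp (j ξ) = E at *
  generalize NormedSpace.exp (j ζ) = F at *
  generalize NormedSpace.exp (-j ξ) = E' at *
  have h1 : E * (j ⁅ξ, H⁆ * l) = E * (l * j ⁅ζ, H⁆) := by
    have h2 : j H * (E * l) = E * l * j H - E * (j ⁅ξ, H⁆ * l) := by
      rw [← mul_assoc, e2, mul_assoc, sub_mul, mul_sub, hl.eq, ← mul_assoc E l]
    have h3 : j H * (l' * F) = l' * F * j H - l' * F * j ⁅ζ, H⁆ := by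
      rw [← mul_assoc, hl'.eq, mul_assoc, e3, ← mul_assoc, mul_sub]
    rw [← h, h2, sub_right_inj] at h3
    rw [h3, mul_assoc]
  have h2 := congrArg (fun a => E' * a) h1
  simpa only [← mul_assoc, e4, one_mul] using h2

theorem map_lie_mem_eigenSum {S : Set ℝ} {x : 𝔤} (hx : x ∈ eigenSum (LieAlgebra.ad ℂ 𝔤 H) S) :
    j ⁅H, x⁆ ∈ eigenSum (LieAlgebra.ad ℂ (Matrix m m ℂ) (j H)) S := by
  refine eigenSum_mapsTo (j : 𝔤 →ₗ[ℂ] Matrix m m ℂ) (fun y => ?_) (lie_mem_eigenSum hx)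
  rw [LieAlgebra.ad_apply, LieAlgebra.ad_apply]
  exact LieHom.map_lie j H y

theorem conj_mem_eigenSum {S : Set ℝ} {h x : Matrix m m ℂ} {l : (Matrix m m ℂ)ˣ}
    (hl : Commute h (l : Matrix m m ℂ))
    (hx : x ∈ eigenSum (LieAlgebra.ad ℂ (Matrix m m ℂ) h) S) :
    (l : Matrix m m ℂ) * x * ((l⁻¹ : (Matrix m m ℂ)ˣ) : Matrix m m ℂ) ∈
      eigenSum (LieAlgebra.ad ℂ (Matrix m m ℂ) h) S := by
  have hli : Commute h ((l⁻¹ : (Matrix m m ℂ)ˣ) : Matrix m m ℂ) := hl.units_inv_right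
  refine eigenSum_mapsTo ((LinearMap.mulRight ℂ ((l⁻¹ : (Matrix m m ℂ)ˣ) : Matrix m m ℂ)) ∘ₗ
    (LinearMap.mulLeft ℂ (l : Matrix m m ℂ))) (fun y => ?_) hx
  simp only [LinearMap.comp_apply, LinearMap.mulLeft_apply, LinearMap.mulRight_apply,
    LieAlgebra.ad_apply, Ring.lie_def]
  generalize (l : Matrix m m ℂ) = a at *
  generalize ((l⁻¹ : (Matrix m m ℂ)ˣ) : Matrix m m ℂ) = b at *
  rw [mul_sub, sub_mul, ← mul_assoc, ← mul_assoc a y h, ← hl.eq, mul_assoc (a * y) h b, hli.eq]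
  simp only [mul_assoc]

/-- If the negative part `ξ` and the positive part `ζ` satisfy `exp ξ * l = l' * exp ζ` with `l`
and `l'` in the Levi subgroup, then they vanish. -/
theorem eq_zero_of_exp_mul_eq (hj : Function.Injective j)
    (hn : ∀ x ∈ nNeg H, ∀ y ∈ nNeg H, ⁅x, y⁆ = 0) (hp : ∀ x ∈ nPos H, ∀ y ∈ nPos H, ⁅x, y⁆ = 0)
    {ξ ζ : 𝔤} {l l' : (Matrix m m ℂ)ˣ} (hξ : ξ ∈ nNeg H) (hζ : ζ ∈ nPos H)
    (hl : Commute (j H) (l : Matrix m m ℂ)) (hl' : Commute (j H) (l' : Matrix m m ℂ))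
    (h : NormedSpace.exp (j ξ) * (l : Matrix m m ℂ) = l' * NormedSpace.exp (j ζ)) :
    ξ = 0 ∧ ζ = 0 := by
  have hξH : ⁅ξ, ⁅ξ, H⁆⁆ = 0 := by
    rw [← lie_skew ξ H, lie_neg, neg_eq_zero]
    exact hn _ hξ _ (lie_mem_eigenSum (S := {r | r < 0}) hξ)
  have hζH : ⁅ζ, ⁅ζ, H⁆⁆ = 0 := by
    rw [← lie_skew ζ H, lie_neg, neg_eq_zero]
    exact hp _ hζ _ (lie_mem_eigenSum (S := {r | 0 < r}) hζ)
  have e4 := map_lie_mul_of_exp_mul_eq hl hl' hξH hζH h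
  have e5 : j ⁅H, ξ⁆ = l * j ⁅H, ζ⁆ * ((l⁻¹ : (Matrix m m ℂ)ˣ) : Matrix m m ℂ) := by
    rw [Units.eq_mul_inv_iff_mul_eq, ← lie_skew H ξ, ← lie_skew H ζ, map_neg, map_neg, neg_mul,
      mul_neg, e4]
  -- By `e5` the same matrix is a sum of eigenvectors of ad j(H) with negative eigenvalues and one
  -- with positive eigenvalues.
  have hm1 : j ⁅H, ξ⁆ ∈ eigenSum (LieAlgebra.ad ℂ (Matrix m m ℂ) (j H)) {r | r < 0} :=
    map_lie_mem_eigenSum hξ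
  have hm3 : j ⁅H, ξ⁆ ∈ eigenSum (LieAlgebra.ad ℂ (Matrix m m ℂ) (j H)) {r | 0 < r} := by
    rw [e5]
    exact conj_mem_eigenSum hl (map_lie_mem_eigenSum hζ)
  have hdisj : Disjoint {r : ℝ | r < 0} {r : ℝ | 0 < r} :=
    Set.disjoint_left.2 fun r h1 h2 => lt_asymm (Set.mem_ofPred.1 h1) (Set.mem_ofPred.1 h2)
  have h0 : j ⁅H, ξ⁆ = 0 :=
    Submodule.disjoint_def.1 (disjoint_eigenSum _ hdisj) _ hm1 hm3
  have h0' : j ⁅H, ζ⁆ = 0 := by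
    have h1 := e5.symm.trans h0
    rw [Units.mul_inv_eq_iff_eq_mul, zero_mul] at h1
    simpa using h1
  exact ⟨eq_zero_of_mem_nNeg_of_lie_eq_zero hξ (hj (by rw [h0, map_zero])),
    eq_zero_of_mem_nPos_of_lie_eq_zero hζ (hj (by rw [h0', map_zero]))⟩

/-- As 𝔫₋ and 𝔫₊ are abelian, two decompositions combine into exp(x - x')·l = l'·exp(z' - z), and
both differences vanish. This makes the chosen value of `gnProj` computable. -/
theorem isGelfandNaimark_unique (hj : Function.Injective j)
    (hn : ∀ x ∈ nNeg H, ∀ y ∈ nNeg H, ⁅x, y⁆ = 0) (hp : ∀ x ∈ nPos H, ∀ y ∈ nPos H, ⁅x, y⁆ = 0)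
    {g : Matrix m m ℂ} {d d' : nNeg H × (Matrix m m ℂ)ˣ × nPos H}
    (hd : IsGelfandNaimark j H g d) (hd' : IsGelfandNaimark j H g d') : d = d' := by
  obtain ⟨⟨x, hx⟩, l, ⟨z, hz⟩⟩ := d
  obtain ⟨⟨x', hx'⟩, l', ⟨z', hz'⟩⟩ := d'
  obtain ⟨hl, hg⟩ := hd
  obtain ⟨hl', hg'⟩ := hd'
  replace hl := commute_of_mem_leviGroup hl
  replace hl' := commute_of_mem_leviGroup hl'
  simp only at hl hl' hg hg'
  have e1 : NormedSpace.exp (j (x - x')) * (l : Matrix m m ℂ) =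
      l' * NormedSpace.exp (j (z' - z)) := by
    rw [exp_map_sub (hn _ hx _ hx'), exp_map_sub' (hp _ hz' _ hz)]
    have h1 := congrArg (fun a => NormedSpace.exp (-j x') * a * NormedSpace.exp (-j z))
      (hg.symm.trans hg')
    simp only [mul_assoc, matrix_exp_mul_exp_neg, mul_one] at h1
    rw [mul_assoc, h1]
    simp only [← mul_assoc, matrix_exp_neg_mul_exp, one_mul]
  obtain ⟨hξ, hζ⟩ := eq_zero_of_exp_mul_eq hj hn hp (sub_mem hx hx') (sub_mem hz' hz) hl hl' e1
  rw [hξ, hζ] at e1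
  simp only [map_zero, NormedSpace.exp_zero, one_mul, mul_one] at e1
  obtain rfl := sub_eq_zero.1 hξ
  obtain rfl := sub_eq_zero.1 hζ
  obtain rfl := Units.ext e1
  rfl

theorem gnProj_eq (hj : Function.Injective j)
    (hn : ∀ x ∈ nNeg H, ∀ y ∈ nNeg H, ⁅x, y⁆ = 0) (hp : ∀ x ∈ nPos H, ∀ y ∈ nPos H, ⁅x, y⁆ = 0)
    {g : Matrix m m ℂ} {d : nNeg H × (Matrix m m ℂ)ˣ × nPos H}
    (hd : IsGelfandNaimark j H g d) : gnProj j H g = d := by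
  have h : ∃ d, IsGelfandNaimark j H g d := ⟨d, hd⟩
  rw [gnProj, dif_pos h]
  exact isGelfandNaimark_unique hj hn hp h.choose_spec hd

/-- The exponential of an element of `j(𝔤)` as an element of the linear group. -/
noncomputable def expUnit (x : Matrix m m ℂ) : (Matrix m m ℂ)ˣ :=
  ⟨NormedSpace.exp x, NormedSpace.exp (-x), matrix_exp_mul_exp_neg x, matrix_exp_neg_mul_exp x⟩

theorem expUnit_mem_linearGroup (x : 𝔤) : expUnit (j x) ∈ linearGroup j :=
  Subgroup.subset_closure ⟨x, rfl⟩

/-- The decomposition of the curve `exp (t Y) exp X` for small `t`. -/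
theorem exists_curve_decomposition [FiniteDimensional ℂ 𝔤] {Y : 𝔤} (hY : Y ∈ nPos H) (X : nNeg H)
    (hn : ∀ x ∈ nNeg H, ∀ y ∈ nNeg H, ⁅x, y⁆ = 0) (hp : ∀ x ∈ nPos H, ∀ y ∈ nPos H, ⁅x, y⁆ = 0)
    (hl : ∀ x ∈ nNeg H, ⁅x, Y⁆ ∈ levi H) :
    ∃ (x : ℝ → nNeg H) (l k : ℝ → Matrix m m ℂ) (w : ℝ → nPos H),
      HasDerivAt (fun t => j (x t)) (j ((2⁻¹ : ℂ) • ⁅(X : 𝔤), ⁅(X : 𝔤), Y⁆⁆)) 0 ∧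
      HasDerivAt l (j (-⁅(X : 𝔤), Y⁆)) 0 ∧
      ∀ᶠ t in 𝓝 (0 : ℝ), l t * k t = 1 ∧ k t * l t = 1 ∧ Commute (j H) (l t) ∧
        NormedSpace.exp (t • j Y) * NormedSpace.exp (j X) =
          NormedSpace.exp (j (x t)) * l t * NormedSpace.exp (j (w t)) := by
  have hnl : ∀ x ∈ nNeg H, ∀ u ∈ levi H, ⁅x, u⁆ ∈ nNeg H := fun x hx u hu => by
    rw [← lie_skew]
    exact neg_mem (lie_levi_mem_eigenSum (S := {r | r < 0}) hx hu)
  have hYl : ∀ x ∈ nNeg H, ⁅Y, x⁆ ∈ levi H := fun x hx => by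
    rw [← lie_skew]
    exact neg_mem (hl x hx)
  obtain ⟨eU⟩ : Nonempty ((Fin (Module.finrank ℂ (nNeg H)) → ℂ) ≃ₗ[ℂ] nNeg H) :=
    ⟨(Module.finBasis ℂ (nNeg H)).equivFun.symm⟩
  obtain ⟨eW⟩ : Nonempty ((Fin (Module.finrank ℂ (nPos H)) → ℂ) ≃ₗ[ℂ] nPos H) :=
    ⟨(Module.finBasis ℂ (nPos H)).equivFun.symm⟩
  obtain ⟨Jm, hJm⟩ : ∃ Jm : (Fin (Module.finrank ℂ (nNeg H)) → ℂ) →ₗ[ℝ] Matrix m m ℂ,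
      ∀ u, Jm u = j (eU u) :=
    ⟨((j : 𝔤 →ₗ[ℂ] Matrix m m ℂ) ∘ₗ (nNeg H).subtype ∘ₗ eU.toLinearMap).restrictScalars ℝ,
      fun u => rfl⟩
  obtain ⟨Jp, hJp⟩ : ∃ Jp : (Fin (Module.finrank ℂ (nPos H)) → ℂ) →ₗ[ℝ] Matrix m m ℂ,
      ∀ u, Jp u = j (eW u) :=
    ⟨((j : 𝔤 →ₗ[ℂ] Matrix m m ℂ) ∘ₗ (nPos H).subtype ∘ₗ eW.toLinearMap).restrictScalars ℝ,
      fun u => rfl⟩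
  obtain ⟨α, hα⟩ : ∃ α : (Fin (Module.finrank ℂ (nNeg H)) → ℂ) →ₗ[ℝ] Matrix m m ℂ,
      ∀ u, α u = j ⁅Y, (eU u : 𝔤)⁆ :=
    ⟨((j : 𝔤 →ₗ[ℂ] Matrix m m ℂ) ∘ₗ (LieAlgebra.ad ℂ 𝔤 Y : 𝔤 →ₗ[ℂ] 𝔤) ∘ₗ
      (nNeg H).subtype ∘ₗ eU.toLinearMap).restrictScalars ℝ, fun u => rfl⟩
  obtain ⟨Γ, hΓ⟩ : ∃ Γ : (Fin (Module.finrank ℂ (nNeg H)) → ℂ) →ₗ[ℂ]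
      (Fin (Module.finrank ℂ (nPos H)) → ℂ) →ₗ[ℂ] (Fin (Module.finrank ℂ (nPos H)) → ℂ),
      ∀ u v, (eW (Γ u v) : 𝔤) = ⁅⁅Y, (eU u : 𝔤)⁆, (eW v : 𝔤)⁆ := by
    refine ⟨LinearMap.mk₂ ℂ (fun u v => eW.symm (⟨⁅⁅Y, (eU u : 𝔤)⁆, (eW v : 𝔤)⁆,
        lie_levi_mem_eigenSum (S := {r | 0 < r}) (eW v).2 (hYl _ (eU u).2)⟩ : nPos H))
      ?_ ?_ ?_ ?_, fun u v => ?_⟩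
    · intro u u' v; rw [← map_add]; congr 1; ext; simp
    · intro c u v; rw [← map_smul]; congr 1; ext; simp [smul_sub]
    · intro u v v'; rw [← map_add]; congr 1; ext; simp
    · intro c u v; rw [← map_smul]; congr 1; ext; simp [smul_sub]
    · rw [LinearMap.mk₂_apply, LinearEquiv.apply_symm_apply]
  obtain ⟨β, hβ⟩ : ∃ β : (Fin (Module.finrank ℂ (nNeg H)) → ℂ) →ₗ[ℂ]
      (Fin (Module.finrank ℂ (nNeg H)) → ℂ) →ₗ[ℂ] (Fin (Module.finrank ℂ (nNeg H)) → ℂ),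
      ∀ u v, (eU (β u v) : 𝔤) = (2⁻¹ : ℂ) • ⁅(eU u : 𝔤), ⁅(eU v : 𝔤), Y⁆⁆ := by
    refine ⟨LinearMap.mk₂ ℂ (fun u v => eU.symm (⟨(2⁻¹ : ℂ) • ⁅(eU u : 𝔤), ⁅(eU v : 𝔤), Y⁆⁆,
        (nNeg H).smul_mem _ (hnl _ (eU u).2 _ (hl _ (eU v).2))⟩ : nNeg H))
      ?_ ?_ ?_ ?_, fun u v => ?_⟩
    · intro u u' v; rw [← map_add]; congr 1; ext; simp
    · intro c u v; rw [← map_smul]; congr 1; ext; simp [smul_comm c]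
    · intro u v v'; rw [← map_add]; congr 1; ext; simp
    · intro c u v; rw [← map_smul]; congr 1; ext; simp [smul_comm c]
    · rw [LinearMap.mk₂_apply, LinearEquiv.apply_symm_apply]
  have hYe : Jp (eW.symm ⟨Y, hY⟩) = j Y := by
    rw [hJp, LinearEquiv.apply_symm_apply]
  have hXe : (eU (eU.symm X) : 𝔤) = X := by rw [LinearEquiv.apply_symm_apply]
  have hconj : ∀ u, Jp (eW.symm ⟨Y, hY⟩) * NormedSpace.exp (Jm u) =
      NormedSpace.exp (Jm u) * (Jp (eW.symm ⟨Y, hY⟩) + α u + Jm (β u u)) := by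
    intro u
    rw [hYe, hJm, hα, hJm, hβ]
    have h2 := hnl _ (eU u).2 _ (hl _ (eU u).2)
    rw [matrix_mul_exp_eq_of_lie_eq_zero (map_lie_eq _ _) (map_lie_eq _ _)
      (commute_map_of_lie_eq_zero (hn _ (eU u).2 _ h2)), ← lie_skew Y, map_neg, map_smul,
      ← sub_eq_add_neg]
    congr 2
    ext i k
    simp
  obtain ⟨u, l, k, w, hu', hl', hev⟩ := matrix_exists_decomposition_curve Jm Jp α
    (Γ.restrictScalars₁₂ ℝ ℝ) (β.restrictScalars₁₂ ℝ ℝ) (eW.symm ⟨Y, hY⟩) (eU.symm X)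
    (fun u v => by
      rw [hJm, hJm]
      exact commute_map_of_lie_eq_zero (hn _ (eU u).2 _ (eU v).2))
    (fun u v => by
      rw [hJp, hJp]
      exact commute_map_of_lie_eq_zero (hp _ (eW u).2 _ (eW v).2))
    hconj (fun u v => by
      rw [LinearMap.restrictScalars₁₂_apply_apply, hα, hJp, hJp, hΓ, map_lie_eq])
  refine ⟨fun t => eU (u t), l, k, fun t => eW (w t), ?_, ?_, ?_⟩
  · rw [LinearMap.restrictScalars₁₂_apply_apply, hJm, hβ, hXe] at hu'
    simpa only [hJm] using hu'
  · rw [hα, hXe, ← lie_skew] at hl'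
    exact hl'
  · filter_upwards [hev] with t ht
    obtain ⟨h1, h2, h3, h4⟩ := ht
    -- The values of α lie in j(𝔩), hence commute with j(H), and the flow passes this on to l.
    refine ⟨h1, h2, h3 _ fun u => ?_, ?_⟩
    · rw [hα]
      exact commute_map_of_lie_eq_zero (mem_levi.1 (hYl _ (eU u).2))
    · rwa [hYe, hJm, hJm, hJp, hXe] at h4

/-- Solving for the middle factor writes it as a product of exponentials and their inverses, so the
ODE need not be shown to stay in the group. -/
theorem mem_linearGroup_of_exp_mul_exp_eq {x y z w : 𝔤} {l : (Matrix m m ℂ)ˣ}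
    (h : NormedSpace.exp (j y) * NormedSpace.exp (j x) =
      NormedSpace.exp (j z) * (l : Matrix m m ℂ) * NormedSpace.exp (j w)) :
    l ∈ linearGroup j := by
  have : l = (expUnit (j z))⁻¹ * (expUnit (j y) * expUnit (j x)) * (expUnit (j w))⁻¹ := by
    rw [eq_mul_inv_iff_mul_eq, eq_inv_mul_iff_mul_eq]
    ext1
    simp only [Units.val_mul, expUnit]
    rw [← mul_assoc]
    exact h.symm
  rw [this]
  exact mul_mem (mul_mem (inv_mem (expUnit_mem_linearGroup _))
    (mul_mem (expUnit_mem_linearGroup _) (expUnit_mem_linearGroup _)))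
    (inv_mem (expUnit_mem_linearGroup _))

/-- For `Y ∈ 𝔫₊` and `X ∈ 𝔫₋` one has `α(Y, X) = -[X, Y]` and `β(Y, X) = [X, [X, Y]] / 2`. -/
theorem isAlpha_isBeta [FiniteDimensional ℂ 𝔤] [LieAlgebra.HasCentralRadical ℂ 𝔤]
    (hj : Function.Injective j) (hH : IsHyperbolic H)
    (hab : ∀ Y ∈ nPos H, ∀ Z ∈ nPos H, ⁅Y, Z⁆ = 0) {Y : 𝔤} (hY : Y ∈ nPos H) (X : nNeg H)
    {a : levi H} {b : nNeg H} (ha : (a : 𝔤) = -⁅(X : 𝔤), Y⁆)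
    (hb : (b : 𝔤) = (2⁻¹ : ℂ) • ⁅(X : 𝔤), ⁅(X : 𝔤), Y⁆⁆) :
    IsAlpha j H Y X a ∧ IsBeta j H Y X b := by
  have hn : ∀ x ∈ nNeg H, ∀ y ∈ nNeg H, ⁅x, y⁆ = 0 := fun x hx y hy =>
    lie_eq_zero_of_mem_nNeg hH hab hx hy
  have hl : ∀ x ∈ nNeg H, ⁅x, Y⁆ ∈ levi H := fun x hx => lie_mem_levi hH hab hx hY
  obtain ⟨x, l, k, w, hx', hl', hev⟩ := exists_curve_decomposition (j := j) hY X hn hab hl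
  have hcurve : ∀ᶠ t : ℝ in 𝓝 0, ∃ g : (Matrix m m ℂ)ˣ, (g : Matrix m m ℂ) = l t ∧
      IsGelfandNaimark j H (curve j Y X t) (x t, g, w t) := by
    filter_upwards [hev] with t ht
    obtain ⟨h1, h2, h3, h4⟩ := ht
    have hcu : curve j Y X t = NormedSpace.exp (t • j Y) * NormedSpace.exp (j X) := rfl
    rw [← hcu] at h4
    refine ⟨⟨l t, k t, h1, h2⟩, rfl, ⟨?_, ?_⟩, h4⟩
    · refine mem_linearGroup_of_exp_mul_exp_eq (j := j) (x := (X : 𝔤)) (y := (t : ℂ) • Y)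
        (z := (x t : 𝔤)) (w := (w t : 𝔤)) ?_
      rw [map_smul]
      exact h4
    · change l t * j H * k t = j H
      rw [← h3.eq, mul_assoc, h1, mul_one]
  have hreg : ∀ᶠ t : ℝ in 𝓝 0, ∃ d, IsGelfandNaimark j H (curve j Y X t) d :=
    hcurve.mono fun t ⟨g, _, h⟩ => ⟨_, h⟩
  refine ⟨⟨hreg, ?_⟩, ⟨hreg, ?_⟩⟩
  · rw [ha]
    refine matrix_hasDerivAt_congr hl' ?_
    filter_upwards [hcurve] with t ht
    obtain ⟨g, hg, h⟩ := ht
    rw [gnProj_eq hj hn hab h, hg]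
  · rw [hb]
    refine matrix_hasDerivAt_congr hx' ?_
    filter_upwards [hcurve] with t ht
    obtain ⟨g, hg, h⟩ := ht
    rw [gnProj_eq hj hn hab h]

end Decomposition

end FMethod

namespace FMethod

/-! ### Normal forms in the Weyl algebra -/

section NormalForm

/-- The monomials in a family of commuting elements. -/
noncomputable def commPow {κ : Type*} [Fintype κ] {A : Type*} [Monoid A] (f : κ → A)
    (hf : ∀ i k, Commute (f i) (f k)) : (κ → Multiplicative ℕ) →* A :=
  MonoidHom.noncommPiCoprod (fun i => powersHom A (f i))
    (fun i k _ x y => by simpa using (hf i k).pow_pow _ _)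

theorem commPow_mulSingle {κ : Type*} [Fintype κ] [DecidableEq κ] {A : Type*} [Monoid A]
    (f : κ → A) (hf : ∀ i k, Commute (f i) (f k)) (i : κ) (n : ℕ) :
    commPow f hf (Pi.mulSingle i (Multiplicative.ofAdd n)) = f i ^ n := by
  classical
  have := MonoidHom.noncommPiCoprod_mulSingle (fun i => powersHom A (f i))
    (hcomm := fun i k _ x y => by simpa using (hf i k).pow_pow _ _) i (Multiplicative.ofAdd n)
  simpa [commPow] using this

theorem closure_range_le_mrange_commPow {κ : Type*} [Fintype κ] {A : Type*} [Monoid A]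
    (f : κ → A) (hf : ∀ i k, Commute (f i) (f k)) :
    Submonoid.closure (Set.range f) ≤ MonoidHom.mrange (commPow f hf) := by
  classical
  rw [Submonoid.closure_le]
  rintro _ ⟨i, rfl⟩
  exact ⟨Pi.mulSingle i (Multiplicative.ofAdd 1), by rw [commPow_mulSingle, pow_one]⟩

variable {κ : Type*}

theorem weyl_adjoin_eq_top :
    Algebra.adjoin ℂ (Set.range (wz : κ → WeylAlgebra κ) ∪ Set.range wd) = ⊤ := by
  rw [eq_top_iff]
  intro x hx
  clear hx
  obtain ⟨y, rfl⟩ := RingQuot.mkAlgHom_surjective ℂ (WeylRel κ) x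
  change weylMk κ y ∈ _
  induction y using FreeAlgebra.induction with
  | grade0 r => rw [AlgHom.commutes]; exact Subalgebra.algebraMap_mem _ r
  | grade1 i =>
    refine Algebra.subset_adjoin ?_
    cases i with
    | inl i => exact Or.inl ⟨i, rfl⟩
    | inr i => exact Or.inr ⟨i, rfl⟩
  | mul a b ha hb => rw [map_mul]; exact mul_mem ha hb
  | add a b ha hb => rw [map_add]; exact add_mem ha hb

theorem wd_commutator_mem_adjoin_wz (i : κ) {a : WeylAlgebra κ}
    (ha : a ∈ Algebra.adjoin ℂ (Set.range (wz : κ → WeylAlgebra κ))) :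
    wd i * a - a * wd i ∈ Algebra.adjoin ℂ (Set.range (wz : κ → WeylAlgebra κ)) := by
  induction ha using Algebra.adjoin_induction with
  | mem x hx =>
    obtain ⟨k, rfl⟩ := hx
    by_cases h : i = k
    · subst h
      rw [wd_mul_wz_same, add_sub_cancel_left]
      exact one_mem _
    · rw [wd_mul_wz_ne i k h, sub_self]
      exact zero_mem _
  | algebraMap r =>
    rw [Algebra.commutes, sub_self]
    exact zero_mem _
  | add x y hx hy h1 h2 =>
    rw [show wd i * (x + y) - (x + y) * wd i = (wd i * x - x * wd i) + (wd i * y - y * wd i) by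
      noncomm_ring]
    exact add_mem h1 h2
  | mul x y hx hy h1 h2 =>
    rw [show wd i * (x * y) - (x * y) * wd i = (wd i * x - x * wd i) * y +
      x * (wd i * y - y * wd i) by noncomm_ring]
    exact add_mem (mul_mem h1 hy) (mul_mem hx h2)

/-- The span of products (polynomial in z)(polynomial in ∂) contains 1 and is stable under left
multiplication by the generators: bracketing with ∂_i preserves the polynomials in z. -/
theorem adjoin_wz_mul_adjoin_wd :
    Subalgebra.toSubmodule (Algebra.adjoin ℂ (Set.range (wz : κ → WeylAlgebra κ))) *
      Subalgebra.toSubmodule (Algebra.adjoin ℂ (Set.range (wd : κ → WeylAlgebra κ))) = ⊤ := by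
  set Z := Algebra.adjoin ℂ (Set.range (wz : κ → WeylAlgebra κ))
  set D := Algebra.adjoin ℂ (Set.range (wd : κ → WeylAlgebra κ))
  set S := Subalgebra.toSubmodule Z * Subalgebra.toSubmodule D
  have hmem : ∀ z ∈ Z, ∀ d ∈ D, z * d ∈ S := fun z hz d hd => Submodule.mul_mem_mul hz hd
  have key : ∀ w : WeylAlgebra κ, ∀ s ∈ S, w * s ∈ S := by
    intro w
    have hw : w ∈ Algebra.adjoin ℂ (Set.range (wz : κ → WeylAlgebra κ) ∪ Set.range wd) := by
      rw [weyl_adjoin_eq_top]; trivial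
    induction hw using Algebra.adjoin_induction with
    | mem x hx =>
      intro s hs
      induction hs using Submodule.mul_induction_on' with
      | mem_mul_mem z hz d hd =>
        rcases hx with ⟨i, rfl⟩ | ⟨i, rfl⟩
        · rw [← mul_assoc]
          exact hmem _ (mul_mem (Algebra.subset_adjoin ⟨i, rfl⟩) hz) _ hd
        · rw [show wd i * (z * d) = z * (wd i * d) + (wd i * z - z * wd i) * d by noncomm_ring]
          exact add_mem (hmem _ hz _ (mul_mem (Algebra.subset_adjoin ⟨i, rfl⟩) hd))
            (hmem _ (wd_commutator_mem_adjoin_wz i hz) _ hd)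
      | add x _ y _ h1 h2 => rw [mul_add]; exact add_mem h1 h2
    | algebraMap r =>
      intro s hs
      rw [← Algebra.smul_def]
      exact S.smul_mem r hs
    | add x y _ _ h1 h2 => intro s hs; rw [add_mul]; exact add_mem (h1 s hs) (h2 s hs)
    | mul x y _ _ h1 h2 => intro s hs; rw [mul_assoc]; exact h1 _ (h2 s hs)
  rw [eq_top_iff]
  intro w _
  have h1 : (1 : WeylAlgebra κ) ∈ S := by
    simpa using hmem 1 (one_mem _) 1 (one_mem _)
  simpa using key w 1 h1

theorem commute_wz (i k : κ) : Commute (wz i) (wz k) := wz_mul_wz i k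

theorem commute_wd (i k : κ) : Commute (wd i) (wd k) := wd_mul_wd i k

section Coeff

variable {V : Type*} [AddCommGroup V] [Module ℂ V]

@[simp] theorem vact_tmul_tmul (w : WeylAlgebra κ) (f : Module.End ℂ V) (p : MvPolynomial κ ℂ)
    (v : V) : vact (w ⊗ₜ[ℂ] f) (p ⊗ₜ[ℂ] v) = weylAct w p ⊗ₜ[ℂ] f v := rfl

/-- The coefficient of a monomial in a vector-valued polynomial. -/
noncomputable def vcoeff (I : κ →₀ ℕ) : VPol κ V →ₗ[ℂ] V :=
  (TensorProduct.lid ℂ V).toLinearMap ∘ₗ LinearMap.rTensor V (MvPolynomial.lcoeff ℂ I)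

@[simp] theorem vcoeff_tmul (I : κ →₀ ℕ) (p : MvPolynomial κ ℂ) (v : V) :
    vcoeff I (p ⊗ₜ[ℂ] v) = p.coeff I • v := by
  simp [vcoeff]

end Coeff

variable [Fintype κ]

/-- The monomial `z ^ I` in the Weyl algebra. -/
noncomputable def wzPow : (κ → Multiplicative ℕ) →* WeylAlgebra κ := commPow wz commute_wz

/-- The monomial `∂ ^ J` in the Weyl algebra. -/
noncomputable def wdPow : (κ → Multiplicative ℕ) →* WeylAlgebra κ := commPow wd commute_wd

theorem span_wzPow_mul_wdPow :
    Submodule.span ℂ (Set.range fun p : (κ → Multiplicative ℕ) × (κ → Multiplicative ℕ) =>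
      (wzPow p.1 * wdPow p.2 : WeylAlgebra κ)) = ⊤ := by
  rw [eq_top_iff, ← adjoin_wz_mul_adjoin_wd, Algebra.adjoin_eq_span, Algebra.adjoin_eq_span,
    Submodule.span_mul_span]
  refine Submodule.span_mono ?_
  rintro _ ⟨a, ha, b, hb, rfl⟩
  obtain ⟨I, rfl⟩ := closure_range_le_mrange_commPow wz commute_wz ha
  obtain ⟨J, rfl⟩ := closure_range_le_mrange_commPow wd commute_wd hb
  exact ⟨(I, J), rfl⟩

/-- The exponent vector of a monomial. -/
noncomputable def expVec (I : κ → Multiplicative ℕ) : κ →₀ ℕ :=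
  Finsupp.equivFunOnFinite.symm fun i => (I i).toAdd

@[simp] theorem expVec_apply (I : κ → Multiplicative ℕ) (i : κ) : expVec I i = (I i).toAdd := rfl

theorem expVec_injective : Function.Injective (expVec : (κ → Multiplicative ℕ) → κ →₀ ℕ) := by
  intro I J h
  funext i
  exact Multiplicative.toAdd.injective (DFunLike.congr_fun h i)

theorem expVec_mul (I J : κ → Multiplicative ℕ) : expVec (I * J) = expVec I + expVec J := by
  ext i
  simp

theorem pi_multiplicative_induction {p : (κ → Multiplicative ℕ) → Prop} [DecidableEq κ]
    (hmul : ∀ I J, p I → p J → p (I * J)) (h1 : p 1)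
    (hs : ∀ i, p (Pi.mulSingle i (Multiplicative.ofAdd 1))) (I : κ → Multiplicative ℕ) : p I := by
  rw [← Finset.univ_prod_mulSingle I]
  refine Finset.prod_induction _ p hmul h1 fun i _ => ?_
  rw [show I i = Multiplicative.ofAdd 1 ^ (I i).toAdd by
    rw [← ofAdd_nsmul, smul_eq_mul, mul_one, ofAdd_toAdd], Pi.mulSingle_pow]
  generalize (I i).toAdd = n
  induction n with
  | zero => simpa using h1
  | succ n ih => rw [pow_succ]; exact hmul _ _ ih (hs i)

theorem expVec_mulSingle [DecidableEq κ] (i : κ) :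
    expVec (Pi.mulSingle i (Multiplicative.ofAdd 1)) = Finsupp.single i 1 := by
  ext k
  by_cases h : k = i
  · subst h; simp
  · simp [Pi.mulSingle_eq_of_ne h, Finsupp.single_eq_of_ne h]

theorem weylAct_wzPow (I : κ → Multiplicative ℕ) (p : MvPolynomial κ ℂ) :
    weylAct (wzPow I) p = MvPolynomial.monomial (expVec I) 1 * p := by
  classical
  induction I using pi_multiplicative_induction generalizing p with
  | hmul I J h1 h2 =>
    rw [map_mul, map_mul, Module.End.mul_apply, h2, h1, ← mul_assoc, MvPolynomial.monomial_mul,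
      expVec_mul, one_mul]
  | h1 =>
    rw [map_one, map_one, Module.End.one_apply, show expVec (1 : κ → Multiplicative ℕ) = 0 from by
      ext i; simp]
    simp
  | hs i =>
    rw [wzPow, commPow_mulSingle, pow_one, weylAct_wz, expVec_mulSingle]
    rfl

/-- The truncated subtraction is harmless: if J is not below K, some descending factorial is zero.
-/
theorem weylAct_wdPow (J : κ → Multiplicative ℕ) (K : κ →₀ ℕ) (c : ℂ) :
    weylAct (wdPow J) (MvPolynomial.monomial K c) =
      MvPolynomial.monomial (K - expVec J)
        (c * ∏ i, ((K i).descFactorial (expVec J i) : ℂ)) := by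
  classical
  induction J using pi_multiplicative_induction generalizing K c with
  | hmul I J h1 h2 =>
    rw [map_mul, map_mul, Module.End.mul_apply, h2, h1, expVec_mul, mul_assoc,
      ← Finset.prod_mul_distrib, tsub_tsub, add_comm (expVec I)]
    congr 2
    refine Finset.prod_congr rfl fun i _ => ?_
    have := Nat.descFactorial_mul_descFactorial (n := K i)
      (Nat.le_add_right (expVec J i) (expVec I i))
    rw [Nat.add_sub_cancel_left] at this
    rw [Finsupp.add_apply, ← this, mul_comm]
    push_cast
    rfl
  | h1 =>
    rw [map_one, map_one, Module.End.one_apply, show expVec (1 : κ → Multiplicative ℕ) = 0 from by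
      ext i; simp]
    simp
  | hs i =>
    rw [wdPow, commPow_mulSingle, pow_one, weylAct_wd, expVec_mulSingle, MvPolynomial.pderiv_monomial]
    congr 2
    rw [Finset.prod_eq_single i]
    · simp
    · intro k _ hk
      simp [Finsupp.single_eq_of_ne hk]
    · simp

variable {V : Type*} [AddCommGroup V] [Module ℂ V]

theorem exists_normal_form (T : VWeyl κ V) :
    ∃ c : ((κ → Multiplicative ℕ) × (κ → Multiplicative ℕ)) →₀ Module.End ℂ V,
      T = c.sum fun p f => (wzPow p.1 * wdPow p.2) ⊗ₜ[ℂ] f := by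
  let Ψ : (((κ → Multiplicative ℕ) × (κ → Multiplicative ℕ)) →₀ Module.End ℂ V) →ₗ[ℂ] VWeyl κ V :=
    Finsupp.lsum ℂ fun p => TensorProduct.mk ℂ (WeylAlgebra κ) (Module.End ℂ V)
      (wzPow p.1 * wdPow p.2)
  suffices h : ∀ T, T ∈ LinearMap.range Ψ by
    obtain ⟨c, rfl⟩ := h T
    exact ⟨c, rfl⟩
  intro T
  induction T using TensorProduct.induction_on with
  | zero => exact zero_mem _
  | add x y hx hy => exact add_mem hx hy
  | tmul w f =>
    have hw : w ∈ Submodule.span ℂ (Set.range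
        fun p : (κ → Multiplicative ℕ) × (κ → Multiplicative ℕ) =>
          (wzPow p.1 * wdPow p.2 : WeylAlgebra κ)) := by
      rw [span_wzPow_mul_wdPow]; trivial
    induction hw using Submodule.span_induction with
    | mem x hx =>
      obtain ⟨p, rfl⟩ := hx
      exact ⟨Finsupp.single p f, by simp [Ψ]⟩
    | zero => rw [TensorProduct.zero_tmul]; exact zero_mem _
    | add x y _ _ hx hy => rw [TensorProduct.add_tmul]; exact add_mem hx hy
    | smul a x _ hx => rw [← TensorProduct.smul_tmul']; exact Submodule.smul_mem _ a hx

/-- `𝒟(E) ⊗ End(V)` acts faithfully on `Pol(E) ⊗ V`. -/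
theorem vact_injective : Function.Injective (vact : VWeyl κ V →ₐ[ℂ] Module.End ℂ (VPol κ V)) := by
  classical
  rw [injective_iff_map_eq_zero]
  intro T hT
  obtain ⟨c, rfl⟩ := exists_normal_form T
  -- Test the operator on z^K and read off the coefficient of z^I. Terms with J' < K vanish by
  -- induction and those with J' not below K kill z^K. The terms with J' = K contribute K!·c(I,K).
  have key : ∀ K : κ →₀ ℕ, ∀ I J, expVec J = K → c (I, J) = 0 := by
    intro K
    induction K using WellFoundedLT.induction with
    | ind K ih =>
      intro I J hJ
      ext v
      have h := congrArg (fun f => vcoeff (expVec I)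
        (f ((MvPolynomial.monomial K (1 : ℂ)) ⊗ₜ[ℂ] v))) hT
      simp only [Finsupp.sum, map_sum, LinearMap.sum_apply, vact_tmul_tmul, vcoeff_tmul,
        LinearMap.zero_apply, map_zero, map_mul, Module.End.mul_apply, weylAct_wdPow,
        weylAct_wzPow, MvPolynomial.monomial_mul, MvPolynomial.coeff_monomial] at h
      rw [Finset.sum_eq_single (I, J)] at h
      · simp only [hJ, tsub_self, add_zero, if_true, one_mul, Nat.descFactorial_self] at h
        rw [smul_eq_zero] at h
        refine h.resolve_left ?_
        refine Finset.prod_ne_zero_iff.2 fun i _ => ?_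
        exact_mod_cast (K i).factorial_ne_zero
      · rintro ⟨I', J'⟩ _ hne
        by_cases hlt : expVec J' < K
        · rw [ih _ hlt I' J' rfl]
          simp
        by_cases hle : expVec J' = K
        · have hJJ : J' = J := expVec_injective (hle.trans hJ.symm)
          have hII : expVec I' ≠ expVec I := fun h => hne (by rw [expVec_injective h, hJJ])
          simp [hle, hII]
        · have : ¬ expVec J' ≤ K := fun h => hlt (lt_of_le_of_ne h hle)
          rw [Finsupp.le_def] at this
          push Not at this
          obtain ⟨i, hi⟩ := this
          have h0 : (∏ i, ((K i).descFactorial (expVec J' i) : ℂ)) = 0 :=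
            Finset.prod_eq_zero (Finset.mem_univ i) (by
              rw [Nat.descFactorial_eq_zero_iff_lt.2 hi, Nat.cast_zero])
          simp only [h0, mul_zero, ite_self, zero_smul]
      · intro h
        rw [Finsupp.notMem_support_iff.1 h]
        simp
  have hc : c = 0 := by
    ext p v
    rw [key _ p.1 p.2 rfl]
    simp
  rw [hc, Finsupp.sum_zero_index]

end NormalForm

end FMethod

namespace FMethod

/-! ### Evaluation, dilations, order -/

section PolyEval

variable {κ : Type*} {E : Type*} [AddCommGroup E] [Module ℂ E] (e : Module.Basis κ ℂ E)
  {V : Type*} [AddCommGroup V] [Module ℂ V]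

@[simp] theorem polyEval_tmul (x : E) (p : MvPolynomial κ ℂ) (v : V) :
    polyEval e x (p ⊗ₜ[ℂ] v) = MvPolynomial.aeval (fun i => e.repr x i) p • v := by
  simp [polyEval]

/-- Vector-valued polynomials are determined by their values. -/
theorem eq_zero_of_polyEval_eq_zero [Finite κ] {F : VPol κ V} (h : ∀ x, polyEval e x F = 0) :
    F = 0 := by
  classical
  have : Fintype κ := Fintype.ofFinite κ
  let B := Module.Free.chooseBasis ℂ V
  -- Coordinates in a basis of V reduce to scalar polynomials, which are determined by their values
  -- over the infinite field ℂ.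
  have hB : ∀ i, LinearMap.lTensor (MvPolynomial κ ℂ) (B.coord i) F = 0 := by
    intro i
    apply (TensorProduct.rid ℂ (MvPolynomial κ ℂ)).injective
    rw [map_zero]
    apply MvPolynomial.funext
    intro x
    rw [map_zero]
    have h1 : ∀ G : VPol κ V, MvPolynomial.eval x (TensorProduct.rid ℂ (MvPolynomial κ ℂ)
        (LinearMap.lTensor (MvPolynomial κ ℂ) (B.coord i) G)) =
        B.coord i (polyEval e (e.equivFun.symm x) G) := by
      intro G
      induction G using TensorProduct.induction_on with
      | zero => simp
      | add G G' h1 h2 => simp only [map_add, h1, h2]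
      | tmul p v =>
        have h2 : (fun i => e.repr (e.equivFun.symm x) i) = x := by
          funext i
          rw [← Module.Basis.equivFun_apply, LinearEquiv.apply_symm_apply]
        rw [polyEval_tmul, h2, map_smul, LinearMap.lTensor_tmul, TensorProduct.rid_tmul,
          MvPolynomial.smul_eval, MvPolynomial.aeval_eq_eval]
        simp [mul_comm]
    rw [h1, h, map_zero]
  have h2 : ∀ G : VPol κ V, (TensorProduct.equivFinsuppOfBasisRight B G : _ →₀ MvPolynomial κ ℂ) =
      0 → G = 0 := fun G hG => by simpa using hG
  apply h2
  ext1 i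
  have h3 : ∀ G : VPol κ V, TensorProduct.equivFinsuppOfBasisRight B G i =
      TensorProduct.rid ℂ (MvPolynomial κ ℂ)
        (LinearMap.lTensor (MvPolynomial κ ℂ) (B.coord i) G) := by
    intro G
    induction G using TensorProduct.induction_on with
    | zero => simp
    | add G G' h1 h2 => simp only [map_add, Finsupp.add_apply, h1, h2]
    | tmul p v => simp
  rw [h3, hB]
  simp

theorem eq_of_polyEval_vact_eq [Fintype κ] {D D' : VWeyl κ V}
    (h : ∀ x F, polyEval e x (vact D F) = polyEval e x (vact D' F)) : D = D' := by
  apply vact_injective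
  refine LinearMap.ext fun F => ?_
  rw [← sub_eq_zero]
  exact eq_zero_of_polyEval_eq_zero e fun x => by rw [map_sub, h, sub_self]

end PolyEval

/-! ### Degree of operators under dilations. -/

section Homogeneous

variable {κ : Type*}

/-- The dilation `p ↦ p(c · )` of scalar polynomials. -/
noncomputable def scale (c : ℂ) : MvPolynomial κ ℂ →ₐ[ℂ] MvPolynomial κ ℂ :=
  MvPolynomial.aeval fun i => c • (MvPolynomial.X i : MvPolynomial κ ℂ)

/-- The operator `w` on scalar polynomials is homogeneous of degree `d`. -/
def ScalesBy (d : ℤ) (w : WeylAlgebra κ) : Prop :=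
  ∀ c : ℂ, c ≠ 0 → ∀ p, scale c (weylAct w p) = c ^ d • weylAct w (scale c p)

theorem scalesBy_wz (i : κ) : ScalesBy 1 (wz i) := by
  intro c _ p
  rw [weylAct_wz, weylAct_wz, map_mul, zpow_one, scale, MvPolynomial.aeval_X, smul_mul_assoc]

theorem pderiv_scale (c : ℂ) (i : κ) (p : MvPolynomial κ ℂ) :
    MvPolynomial.pderiv i (scale c p) = c • scale c (MvPolynomial.pderiv i p) := by
  classical
  induction p using MvPolynomial.induction_on with
  | C a => simp [scale]
  | add p q hp hq => simp only [map_add, hp, hq, smul_add]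
  | mul_X p k h =>
    have hX : scale c (MvPolynomial.X k : MvPolynomial κ ℂ) = c • MvPolynomial.X k := by
      simp [scale]
    rw [map_mul, Derivation.leibniz, Derivation.leibniz, h, hX, Derivation.map_smul, map_add,
      smul_eq_mul, smul_eq_mul, smul_eq_mul, smul_eq_mul, map_mul, map_mul, hX,
      MvPolynomial.pderiv_X]
    by_cases hk : k = i
    · subst hk
      simp only [Pi.single_eq_same, map_one, mul_one]
      simp only [Algebra.smul_def]
      ring
    · simp only [Pi.single_eq_of_ne hk, map_zero, mul_zero, smul_zero, zero_add]
      simp only [Algebra.smul_def]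
      ring

theorem scalesBy_wd (i : κ) : ScalesBy (-1) (wd i) := by
  intro c hc p
  rw [weylAct_wd, weylAct_wd, pderiv_scale, smul_smul, zpow_neg_one, inv_mul_cancel₀ hc, one_smul]

theorem ScalesBy.mul {d d' : ℤ} {w w' : WeylAlgebra κ} (h : ScalesBy d w) (h' : ScalesBy d' w') :
    ScalesBy (d + d') (w * w') := by
  intro c hc p
  rw [map_mul, Module.End.mul_apply, Module.End.mul_apply, h c hc, h' c hc, map_smul, smul_smul,
    zpow_add₀ hc]

variable {E : Type*} [AddCommGroup E] [Module ℂ E] (e : Module.Basis κ ℂ E)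
  {V : Type*} [AddCommGroup V] [Module ℂ V]

/-- Evaluating at c·ξ is evaluating at ξ after scaling by c, and that scaling cancels the dilation
by c⁻¹ once moved past `w`. -/
theorem ScalesBy.isHomogeneousOfDegree {d : ℤ} {w : WeylAlgebra κ} (h : ScalesBy d w)
    (f : Module.End ℂ V) : IsHomogeneousOfDegree e d (w ⊗ₜ[ℂ] f) := by
  intro c hc F ξ
  induction F using TensorProduct.induction_on with
  | zero => simp
  | add F G h1 h2 => simp only [map_add, smul_add, h1, h2]
  | tmul p v =>
    have h1 : (dilate c⁻¹ (p ⊗ₜ[ℂ] v) : VPol κ V) = scale c⁻¹ p ⊗ₜ[ℂ] v := rfl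
    have h2 : ∀ q : MvPolynomial κ ℂ, MvPolynomial.aeval (fun i => e.repr (c • ξ) i) q =
        MvPolynomial.aeval (fun i => e.repr ξ i) (scale c q) := by
      intro q
      rw [scale, MvPolynomial.comp_aeval_apply]
      simp
    have h3 : scale c (scale c⁻¹ p) = p := by
      rw [scale, scale, MvPolynomial.comp_aeval_apply]
      simp [smul_smul, hc]
    rw [h1, vact_tmul_tmul, vact_tmul_tmul, polyEval_tmul, polyEval_tmul, h2, h c hc, h3, map_smul,
      smul_assoc]

theorem IsHomogeneousOfDegree.add {d : ℤ} {T T' : VWeyl κ V} (h : IsHomogeneousOfDegree e d T)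
    (h' : IsHomogeneousOfDegree e d T') : IsHomogeneousOfDegree e d (T + T') := by
  intro c hc F ξ
  simp only [map_add, LinearMap.add_apply, smul_add, h c hc F ξ, h' c hc F ξ]

theorem IsHomogeneousOfDegree.smul {d : ℤ} {T : VWeyl κ V} (h : IsHomogeneousOfDegree e d T)
    (a : ℂ) : IsHomogeneousOfDegree e d (a • T) := by
  intro c hc F ξ
  simp only [map_smul, LinearMap.smul_apply, h c hc F ξ, smul_comm a]

theorem IsHomogeneousOfDegree.sum {d : ℤ} {ι : Type*} {s : Finset ι} {T : ι → VWeyl κ V}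
    (h : ∀ i ∈ s, IsHomogeneousOfDegree e d (T i)) : IsHomogeneousOfDegree e d (∑ i ∈ s, T i) :=
  Finset.sum_induction T (IsHomogeneousOfDegree e d) (fun _ _ h h' => h.add e h')
    (fun c hc F ξ => by simp) h

end Homogeneous

/-! ### Order via commutators with the coordinates. -/

section Order

variable {κ : Type*} {V : Type*} [AddCommGroup V] [Module ℂ V]

theorem HasOrderLE.zero (n : ℕ) : HasOrderLE n (0 : VWeyl κ V) := by
  induction n with
  | zero => intro i; simp
  | succ n ih => intro i; simpa using ih

theorem HasOrderLE.add {n : ℕ} {T T' : VWeyl κ V} (h : HasOrderLE n T) (h' : HasOrderLE n T') :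
    HasOrderLE n (T + T') := by
  induction n generalizing T T' with
  | zero =>
    intro i
    rw [add_mul, mul_add, add_sub_add_comm, h i, h' i, add_zero]
  | succ n ih =>
    intro i
    rw [add_mul, mul_add, add_sub_add_comm]
    exact ih (h i) (h' i)

theorem HasOrderLE.smul {n : ℕ} {T : VWeyl κ V} (h : HasOrderLE n T) (a : ℂ) :
    HasOrderLE n (a • T) := by
  induction n generalizing T with
  | zero =>
    intro i
    rw [smul_mul_assoc, mul_smul_comm, ← smul_sub, h i, smul_zero]
  | succ n ih =>
    intro i
    rw [smul_mul_assoc, mul_smul_comm, ← smul_sub]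
    exact ih (h i)

theorem HasOrderLE.sum {n : ℕ} {ι : Type*} {s : Finset ι} {T : ι → VWeyl κ V}
    (h : ∀ i ∈ s, HasOrderLE n (T i)) : HasOrderLE n (∑ i ∈ s, T i) :=
  Finset.sum_induction T (HasOrderLE n) (fun _ _ h h' => h.add h') (HasOrderLE.zero n) h

theorem HasOrderLE.succ {n : ℕ} {T : VWeyl κ V} (h : HasOrderLE n T) : HasOrderLE (n + 1) T := by
  induction n generalizing T with
  | zero =>
    intro i
    rw [h i]
    exact HasOrderLE.zero 0
  | succ n ih => exact fun i => ih (h i)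

theorem wd_tmul_commutator [DecidableEq κ] (k i : κ) :
    ((wd k ⊗ₜ[ℂ] 1) * (wz i ⊗ₜ[ℂ] 1) - (wz i ⊗ₜ[ℂ] 1) * (wd k ⊗ₜ[ℂ] 1) : VWeyl κ V) =
      (if k = i then (1 : ℂ) else 0) • 1 := by
  rw [Algebra.TensorProduct.tmul_mul_tmul, Algebra.TensorProduct.tmul_mul_tmul,
    ← TensorProduct.sub_tmul]
  split_ifs with h
  · subst h
    rw [wd_mul_wz_same, add_sub_cancel_left, one_smul, mul_one, Algebra.TensorProduct.one_def]
  · rw [wd_mul_wz_ne k i h, sub_self, TensorProduct.zero_tmul, zero_smul]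

/-- Because [T∂_k, z_i] = δ_{ki}T + [T, z_i]∂_k, induction shows that right multiplication by a
derivation raises the order bound by one. -/
theorem HasOrderLE.mul_wd {n : ℕ} {T : VWeyl κ V} (h : HasOrderLE n T) (k : κ) :
    HasOrderLE (n + 1) (T * (wd k ⊗ₜ[ℂ] 1)) := by
  classical
  have key : ∀ (T : VWeyl κ V) (i : κ), T * (wd k ⊗ₜ[ℂ] 1) * (wz i ⊗ₜ[ℂ] 1) -
      (wz i ⊗ₜ[ℂ] 1) * (T * (wd k ⊗ₜ[ℂ] 1)) = (if k = i then (1 : ℂ) else 0) • T +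
        (T * (wz i ⊗ₜ[ℂ] 1) - (wz i ⊗ₜ[ℂ] 1) * T) * (wd k ⊗ₜ[ℂ] 1) := by
    intro T i
    have h1 := congrArg (fun S => T * S) (wd_tmul_commutator (V := V) k i)
    simp only [mul_smul_comm, mul_one] at h1
    rw [← h1]
    simp only [mul_sub, sub_mul, mul_assoc]
    abel
  induction n generalizing T with
  | zero =>
    intro i
    rw [key, h i, zero_mul, add_zero]
    exact h.smul _
  | succ n ih =>
    intro i
    rw [key]
    exact (h.smul _).add (ih (h i))

theorem hasOrderLE_zero_one_tmul (f : Module.End ℂ V) :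
    HasOrderLE 0 ((1 : WeylAlgebra κ) ⊗ₜ[ℂ] f) := by
  intro i
  rw [Algebra.TensorProduct.tmul_mul_tmul, Algebra.TensorProduct.tmul_mul_tmul]
  simp

theorem hasOrderLE_zero_wz_tmul (k : κ) (f : Module.End ℂ V) :
    HasOrderLE 0 (wz k ⊗ₜ[ℂ] f) := by
  intro i
  rw [Algebra.TensorProduct.tmul_mul_tmul, Algebra.TensorProduct.tmul_mul_tmul, wz_mul_wz]
  simp

theorem hasOrderLE_one_wd_tmul (k : κ) (f : Module.End ℂ V) :
    HasOrderLE 1 (wd k ⊗ₜ[ℂ] f) := by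
  have h := (hasOrderLE_zero_one_tmul (κ := κ) f).mul_wd k
  rwa [Algebra.TensorProduct.tmul_mul_tmul, one_mul, mul_one] at h

theorem hasOrderLE_two_tmul (i k l : κ) (f : Module.End ℂ V) :
    HasOrderLE 2 ((wz i * wd k * wd l) ⊗ₜ[ℂ] f) := by
  have h := ((hasOrderLE_zero_wz_tmul i f).mul_wd k).mul_wd l
  rwa [Algebra.TensorProduct.tmul_mul_tmul, mul_one, Algebra.TensorProduct.tmul_mul_tmul,
    mul_one] at h

end Order

/-! ### The dual basis and the operator -/

section Main

variable {𝔤 : Type*} [LieRing 𝔤] [LieAlgebra ℂ 𝔤] [FiniteDimensional ℂ 𝔤]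
  [LieAlgebra.HasCentralRadical ℂ 𝔤] {H : 𝔤}

/-- A basis of `𝔫₊` dual to a given basis of `𝔫₋` for the Killing form. -/
theorem exists_killing_dual_basis (hH : IsHyperbolic H) {κ : Type*} [Fintype κ] [DecidableEq κ]
    (e : Module.Basis κ ℂ (nNeg H)) :
    ∃ e' : Module.Basis κ ℂ (nPos H),
      ∀ i k : κ, killingForm ℂ 𝔤 (e i : 𝔤) (e' k : 𝔤) = if i = k then 1 else 0 := by
  let B : nNeg H →ₗ[ℂ] nPos H →ₗ[ℂ] ℂ :=
    (killingForm ℂ 𝔤).compl₁₂ (nNeg H).subtype (nPos H).subtype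
  have hB : ∀ x y, B x y = killingForm ℂ 𝔤 (x : 𝔤) (y : 𝔤) := fun x y => rfl
  have hperf : B.IsPerfPair := by
    refine LinearMap.IsPerfPair.of_injective ?_ ?_
    · rw [injective_iff_map_eq_zero]
      intro x hx
      refine Subtype.ext (eq_zero_of_mem_nNeg hH x.2 fun y hy => ?_)
      exact LinearMap.congr_fun hx ⟨y, hy⟩
    · rw [injective_iff_map_eq_zero]
      intro y hy
      refine Subtype.ext (eq_zero_of_mem_nPos hH y.2 fun x hx => ?_)
      rw [LieModule.traceForm_comm]
      exact LinearMap.congr_fun hy ⟨x, hx⟩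
  -- The Killing form is a perfect pairing of 𝔫₋ with 𝔫₊, so the dual basis of functionals is
  -- carried over to 𝔫₊.
  refine ⟨e.dualBasis.map (B.flip.toPerfPair).symm, fun i k => ?_⟩
  rw [← hB, Module.Basis.map_apply]
  have h1 := LinearMap.congr_fun
    (LinearEquiv.apply_symm_apply B.flip.toPerfPair (e.dualBasis k)) (e i)
  rw [Module.Basis.dualBasis_apply_self] at h1
  exact h1

end Main

end FMethod

namespace FMethod

/-! ### The operator `dπ_μ(Y)` and its algebraic Fourier transform -/

section Operator

variable {κ : Type*}

theorem wd_mul_wd_mul_wz [DecidableEq κ] (i k l : κ) :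
    (wd k * wd l * wz i : WeylAlgebra κ) = wz i * wd k * wd l +
      (if l = i then (1 : ℂ) else 0) • wd k + (if k = i then (1 : ℂ) else 0) • wd l := by
  have h : ∀ k i : κ, (wd k * wz i : WeylAlgebra κ) =
      wz i * wd k + (if k = i then (1 : ℂ) else 0) • 1 := by
    intro k i
    split_ifs with h
    · subst h
      rw [wd_mul_wz_same, one_smul]
    · rw [wd_mul_wz_ne k i h, zero_smul, add_zero]
  rw [mul_assoc, h l i, mul_add, ← mul_assoc, h k i, mul_smul_comm, mul_one, add_mul,
    smul_mul_assoc, one_mul]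
  abel

variable [Fintype κ] {N 𝔩 V : Type*} [AddCommGroup N] [Module ℂ N]
  [AddCommGroup 𝔩] [Module ℂ 𝔩] [AddCommGroup V] [Module ℂ V]

/-- The differential operator `F ↦ (x ↦ ν (α x) (F x) - (β(x, x) F)(x))`, where the quadratic map
`x ↦ β(x, x)` is regarded as a vector field. -/
noncomputable def quadraticOperator (e : Module.Basis κ ℂ N) (ν : 𝔩 →ₗ[ℂ] Module.End ℂ V)
    (α : N →ₗ[ℂ] 𝔩) (β : N →ₗ[ℂ] N →ₗ[ℂ] N) : VWeyl κ V :=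
  ∑ k, wz k ⊗ₜ[ℂ] ν (α (e k)) -
    ∑ i, ∑ k, ∑ l, e.repr (β (e k) (e l)) i • ((wz k * wz l * wd i) ⊗ₜ[ℂ] (1 : Module.End ℂ V))

theorem polyEval_vact_quadraticOperator (e : Module.Basis κ ℂ N) (ν : 𝔩 →ₗ[ℂ] Module.End ℂ V)
    (α : N →ₗ[ℂ] 𝔩) (β : N →ₗ[ℂ] N →ₗ[ℂ] N) (x : N) (F : VPol κ V) :
    polyEval e x (vact (quadraticOperator e ν α β) F) = ν (α x) (polyEval e x F) -
      ∑ i, e.repr (β x x) i •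
        polyEval e x (LinearMap.rTensor V (MvPolynomial.pderiv i).toLinearMap F) := by
  have hα : ν (α x) = ∑ k, e.repr x k • ν (α (e k)) := by
    conv_lhs => rw [← e.sum_repr x]
    simp only [map_sum, map_smul]
  have hβ : ∀ i, e.repr (β x x) i =
      ∑ k, ∑ l, e.repr x k * e.repr x l * e.repr (β (e k) (e l)) i := by
    intro i
    have h1 : β x x = ∑ k, ∑ l, (e.repr x k * e.repr x l) • β (e k) (e l) := by
      conv_lhs => rw [← e.sum_repr x]
      simp only [map_sum, map_smul, LinearMap.sum_apply, LinearMap.smul_apply, Finset.smul_sum,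
        smul_smul]
      rw [Finset.sum_comm]
      simp only [mul_comm]
    rw [h1]
    simp only [map_sum, map_smul, Finsupp.coe_finsetSum, Finset.sum_apply, Finsupp.smul_apply,
      smul_eq_mul]
  induction F using TensorProduct.induction_on with
  | zero => simp
  | add F G h1 h2 =>
    simp only [map_add, smul_add, Finset.sum_add_distrib, h1, h2]
    abel
  | tmul p v =>
    rw [quadraticOperator, map_sub, LinearMap.sub_apply, map_sub]
    congr 1
    · simp only [map_sum, LinearMap.sum_apply, vact_tmul_tmul, polyEval_tmul, weylAct_wz, map_mul,
        MvPolynomial.aeval_X, hα, LinearMap.smul_apply, map_smul,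
        Finset.smul_sum, smul_smul]
      refine Finset.sum_congr rfl fun k _ => ?_
      rw [mul_comm]
    · simp only [map_sum, map_smul, LinearMap.sum_apply, LinearMap.smul_apply, vact_tmul_tmul,
        polyEval_tmul, weylAct_wz, weylAct_wd, map_mul, Module.End.mul_apply, Module.End.one_apply,
        MvPolynomial.aeval_X, hβ, LinearMap.rTensor_tmul, Finset.sum_mul, Finset.sum_smul,
        smul_smul]
      refine Finset.sum_congr rfl fun i _ => Finset.sum_congr rfl fun k _ =>
        Finset.sum_congr rfl fun l _ => ?_
      congr 1
      change _ = _ * MvPolynomial.aeval _ (MvPolynomial.pderiv i p)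
      ring

/-- Each z_k z_l ∂_i becomes -∂_k ∂_l ξ^i; the minus sign cancels the one in front of the vector
field. Normal ordering leaves two Kronecker terms, which sum to the two partial traces of β. -/
theorem vfourier_quadraticOperator [DecidableEq κ] (e : Module.Basis κ ℂ N)
    (ν : 𝔩 →ₗ[ℂ] Module.End ℂ V) (α : N →ₗ[ℂ] 𝔩) (β : N →ₗ[ℂ] N →ₗ[ℂ] N) :
    vfourier (quadraticOperator e ν α β) =
      ∑ i, ∑ k, ∑ l, e.repr (β (e k) (e l)) i •
        ((wz i * wd k * wd l) ⊗ₜ[ℂ] (1 : Module.End ℂ V)) +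
      ∑ k, wd k ⊗ₜ[ℂ] (ν (α (e k)) +
        (∑ l, (e.repr (β (e k) (e l)) l + e.repr (β (e l) (e k)) l)) • (1 : Module.End ℂ V)) := by
  have hv : ∀ (w : WeylAlgebra κ) (f : Module.End ℂ V),
      vfourier (w ⊗ₜ[ℂ] f) = fourier w ⊗ₜ[ℂ] f := fun w f => rfl
  have h1 : ∀ (i k l : κ) (c : ℂ),
      vfourier (c • ((wz k * wz l * wd i) ⊗ₜ[ℂ] (1 : Module.End ℂ V))) =
        -(c • ((wz i * wd k * wd l) ⊗ₜ[ℂ] (1 : Module.End ℂ V)) +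
          (if l = i then c else 0) • (wd k ⊗ₜ[ℂ] (1 : Module.End ℂ V)) +
          (if k = i then c else 0) • (wd l ⊗ₜ[ℂ] (1 : Module.End ℂ V))) := by
    intro i k l c
    rw [map_smul, hv, map_mul, map_mul, fourier_wz, fourier_wz, fourier_wd, mul_neg,
      wd_mul_wd_mul_wz, TensorProduct.neg_tmul, TensorProduct.add_tmul, TensorProduct.add_tmul,
      ← TensorProduct.smul_tmul', ← TensorProduct.smul_tmul', smul_neg, smul_add, smul_add,
      smul_smul, smul_smul, mul_ite, mul_ite, mul_one, mul_zero]
  rw [quadraticOperator, map_sub]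
  simp only [map_sum, h1, hv, fourier_wz, Finset.sum_neg_distrib, sub_neg_eq_add,
    Finset.sum_add_distrib, TensorProduct.tmul_add, TensorProduct.tmul_smul]
  have h2 : ∑ i, ∑ k, ∑ l, (if l = i then e.repr (β (e k) (e l)) i else 0) •
      (wd k ⊗ₜ[ℂ] (1 : Module.End ℂ V)) =
      ∑ k, (∑ l, e.repr (β (e k) (e l)) l) • (wd k ⊗ₜ[ℂ] (1 : Module.End ℂ V)) := by
    rw [Finset.sum_comm]
    refine Finset.sum_congr rfl fun k _ => ?_
    rw [Finset.sum_smul]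
    refine Finset.sum_congr rfl fun i _ => ?_
    simp only [ite_smul, zero_smul, Finset.sum_ite_eq', Finset.mem_univ, if_true]
  have h3 : ∑ i, ∑ k, ∑ l, (if k = i then e.repr (β (e k) (e l)) i else 0) •
      (wd l ⊗ₜ[ℂ] (1 : Module.End ℂ V)) =
      ∑ k, (∑ l, e.repr (β (e l) (e k)) l) • (wd k ⊗ₜ[ℂ] (1 : Module.End ℂ V)) := by
    simp only [Finset.sum_smul]
    rw [Finset.sum_comm (s := Finset.univ) (t := Finset.univ)
      (f := fun k l => e.repr (β (e l) (e k)) l • (wd k ⊗ₜ[ℂ] (1 : Module.End ℂ V)))]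
    refine Finset.sum_congr rfl fun i _ => ?_
    rw [Finset.sum_comm]
    refine Finset.sum_congr rfl fun l _ => ?_
    simp only [ite_smul, zero_smul, Finset.sum_ite_eq', Finset.mem_univ, if_true]
  rw [h2, h3]
  simp only [add_smul, Finset.sum_add_distrib]
  abel

end Operator

/-! ### Existence and uniqueness of the infinitesimal action. -/

section Action

variable {𝔤 : Type*} [LieRing 𝔤] [LieAlgebra ℂ 𝔤] {H : 𝔤} {m : Type*} [Fintype m] [DecidableEq m]
  {j : 𝔤 →ₗ⁅ℂ⁆ Matrix m m ℂ}

theorem exists_linear_alpha_quadratic_beta [FiniteDimensional ℂ 𝔤]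
    [LieAlgebra.HasCentralRadical ℂ 𝔤] (hj : Function.Injective j) (hH : IsHyperbolic H)
    (hab : ∀ Y ∈ nPos H, ∀ Z ∈ nPos H, ⁅Y, Z⁆ = 0) (Y : nPos H) :
    ∃ (α : nNeg H →ₗ[ℂ] levi H) (β : nNeg H →ₗ[ℂ] nNeg H →ₗ[ℂ] nNeg H),
      ∀ X, IsAlpha j H Y X (α X) ∧ IsBeta j H Y X (β X X) := by
  have hl : ∀ x ∈ nNeg H, ⁅x, (Y : 𝔤)⁆ ∈ levi H := fun x hx => lie_mem_levi hH hab hx Y.2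
  have hnl : ∀ x ∈ nNeg H, ∀ u ∈ levi H, ⁅x, u⁆ ∈ nNeg H := fun x hx u hu => by
    rw [← lie_skew]
    exact neg_mem (lie_levi_mem_eigenSum (S := {r | r < 0}) hx hu)
  let α : nNeg H →ₗ[ℂ] levi H :=
    { toFun := fun X => ⟨⁅(Y : 𝔤), (X : 𝔤)⁆, by rw [← lie_skew]; exact neg_mem (hl X X.2)⟩
      map_add' := fun x y => by ext; simp
      map_smul' := fun c x => by ext; simp }
  let β : nNeg H →ₗ[ℂ] nNeg H →ₗ[ℂ] nNeg H :=
    LinearMap.mk₂ ℂ (fun x y => ⟨(2⁻¹ : ℂ) • ⁅(x : 𝔤), ⁅(y : 𝔤), (Y : 𝔤)⁆⁆,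
      (nNeg H).smul_mem _ (hnl _ x.2 _ (hl _ y.2))⟩)
      (fun x y z => by ext; simp) (fun c x y => by ext; simp [smul_comm c])
      (fun x y z => by ext; simp) (fun c x y => by ext; simp [smul_comm c])
  exact ⟨α, β, fun X => isAlpha_isBeta hj hH hab Y.2 X (lie_skew _ _).symm rfl⟩

theorem IsAlpha.unique (hj : Function.Injective j) {Y : 𝔤} {X : nNeg H} {a a' : levi H}
    (h : IsAlpha j H Y X a) (h' : IsAlpha j H Y X a') : a = a' :=
  Subtype.ext (hj (matrix_hasDerivAt_unique h.2 h'.2))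

theorem IsBeta.unique (hj : Function.Injective j) {Y : 𝔤} {X : nNeg H} {b b' : nNeg H}
    (h : IsBeta j H Y X b) (h' : IsBeta j H Y X b') : b = b' :=
  Subtype.ext (hj (matrix_hasDerivAt_unique h.2 h'.2))

theorem IsInfinitesimalAction.unique (hj : Function.Injective j) {κ : Type*} [Fintype κ]
    {V : Type*} [AddCommGroup V] [Module ℂ V] {e : Module.Basis κ ℂ (nNeg H)}
    {μ : levi H →ₗ⁅ℂ⁆ Module.End ℂ V} {Y : 𝔤} {D D' : VWeyl κ V}
    (h : IsInfinitesimalAction j H e μ Y D) (h' : IsInfinitesimalAction j H e μ Y D') : D = D' := by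
  refine eq_of_polyEval_vact_eq e fun X F => ?_
  obtain ⟨a, b, ha, hb, hD⟩ := h X
  obtain ⟨a', b', ha', hb', hD'⟩ := h' X
  rw [hD, hD', ha.unique hj ha', hb.unique hj hb']

end Action

end FMethod

theorem proposition3p8
    {𝔤 : Type*} [LieRing 𝔤] [LieAlgebra ℂ 𝔤] [FiniteDimensional ℂ 𝔤]
    [LieAlgebra.HasCentralRadical ℂ 𝔤]
    {m : Type*} [Fintype m] [DecidableEq m]
    (j : 𝔤 →ₗ⁅ℂ⁆ Matrix m m ℂ) (hj : Function.Injective j)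
    (H : 𝔤) (hH : FMethod.IsHyperbolic H)
    (hab : ∀ Y ∈ FMethod.nPos H, ∀ Z ∈ FMethod.nPos H, ⁅Y, Z⁆ = 0)
    {κ : Type*} [Fintype κ] [DecidableEq κ]
    (e : Module.Basis κ ℂ (FMethod.nNeg H)) :
    ∃ e' : Module.Basis κ ℂ (FMethod.nPos H),
      (∀ i k : κ, killingForm ℂ 𝔤 (e i : 𝔤) (e' k : 𝔤) = if i = k then 1 else 0) ∧
      ∃ a : FMethod.nPos H → κ → κ → κ → ℂ,
        ∀ (V : Type v) [AddCommGroup V] [Module ℂ V]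
          (μ : FMethod.levi H →ₗ⁅ℂ⁆ Module.End ℂ V),
          ∃ b : FMethod.nPos H → κ → Module.End ℂ V,
            ∀ Y : FMethod.nPos H,
              (∃! D : FMethod.VWeyl κ V, FMethod.IsInfinitesimalAction j H e μ (Y : 𝔤) D) ∧
              ∀ D : FMethod.VWeyl κ V, FMethod.IsInfinitesimalAction j H e μ (Y : 𝔤) D →
                FMethod.IsHomogeneousOfDegree e' (-1) (FMethod.vfourier D) ∧
                FMethod.vfourier D =
                  ∑ i, ∑ k, ∑ l, a Y i k l •
                    ((FMethod.wz i * FMethod.wd k * FMethod.wd l) ⊗ₜ[ℂ] (1 : Module.End ℂ V))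
                  + ∑ k, FMethod.wd k ⊗ₜ[ℂ] b Y k ∧
                FMethod.HasOrderLE 2 (FMethod.vfourier D) := by
  obtain ⟨e', he'⟩ := FMethod.exists_killing_dual_basis hH e
  choose α β hαβ using FMethod.exists_linear_alpha_quadratic_beta hj hH hab
  -- The second-order coefficients are the structure constants of β, available before V and μ are
  -- introduced.
  refine ⟨e', he', fun Y i k l => e.repr (β Y (e k) (e l)) i, ?_⟩
  intro V _ _ μ
  -- The scalar summand is the trace correction from normal ordering.
  refine ⟨fun Y k => μ (α Y (e k)) + (∑ l, (e.repr (β Y (e k) (e l)) l +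
    e.repr (β Y (e l) (e k)) l)) • (1 : Module.End ℂ V), fun Y => ?_⟩
  have hD : FMethod.IsInfinitesimalAction j H e μ (Y : 𝔤)
      (FMethod.quadraticOperator e (μ : FMethod.levi H →ₗ[ℂ] Module.End ℂ V) (α Y) (β Y)) :=
    fun X => ⟨α Y X, β Y X X, (hαβ Y X).1, (hαβ Y X).2, fun F =>
      FMethod.polyEval_vact_quadraticOperator e _ (α Y) (β Y) X F⟩
  refine ⟨⟨_, hD, fun D' hD' => hD'.unique hj hD⟩, fun D hD' => ?_⟩
  obtain rfl := hD'.unique hj hD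
  have hF := FMethod.vfourier_quadraticOperator e
    (μ : FMethod.levi H →ₗ[ℂ] Module.End ℂ V) (α Y) (β Y)
  refine ⟨?_, hF, ?_⟩
  · rw [hF]
    -- The degrees add up to 1 - 1 - 1 = -1 in the second-order terms and equal -1 in the
    -- first-order ones.
    exact .add _ (.sum _ fun i _ => .sum _ fun k _ => .sum _ fun l _ => .smul _
        ((((FMethod.scalesBy_wz i).mul (FMethod.scalesBy_wd k)).mul
          (FMethod.scalesBy_wd l)).isHomogeneousOfDegree e' _) _)
      (.sum _ fun k _ => (FMethod.scalesBy_wd k).isHomogeneousOfDegree e' _)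
  · rw [hF]
    exact .add (.sum fun i _ => .sum fun k _ => .sum fun l _ =>
        (FMethod.hasOrderLE_two_tmul i k l _).smul _)
      (.sum fun k _ => (FMethod.hasOrderLE_one_wd_tmul k _).succ)
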